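/- Let $\mathcal H_E,\mathcal H_P$ be finite-dimensional Hilbert spaces (environment and probe), $d_P=\dim\mathcal H_P$, and let $G$ be a Hermitian operator on $\mathcal H_P$ that is not a multiple of the identity. Let $\mathcal H_A$ be a noiseless auxiliary system with $\dim\mathcal H_A=d_P$. Then there are code words $|C_0\rangle,|C_1\rangle\in\mathcal H_P\otimes\mathcal H_A$ (unit vectors with orthogonal supports on $\mathcal H_A$, purifying the normalized positive and negative parts of $G-\frac{\operatorname{Tr}G}{d_P}\mathbb 1$), with code projector $P=|C_0\rangle\langle C_0|+|C_1\rangle\langle C_1|$, and real numbers $\lambda_0>\lambda_1$ with $P(G\otimes\mathbb 1_A)P|C_i\rangle=\lambda_i|C_i\rangle$, such that the following holds; write $\Delta\lambda=\lambda_0-\lambda_1$. Let $H_{EP}$ be any Hermitian operator on $\mathcal H_E\otimes\mathcal H_P$, and let the joint state evolve by $$\frac{d\rho}{dt}=-i[H_{EP},\rho]-i\omega[\mathbb 1_E\otimes G\otimes\mathbb 1_A,\rho],$$ where $\omega\in\mathbb R$ is the parameter to be estimated. There are orthonormal bases $(u_k)$, $(v_l)$ of $\mathcal H_E$ and real numbers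 $a_k,b_l$ with $\langle C_0|H_{EP}|C_0\rangle u_k=a_ku_k$ and $\langle C_1|H_{EP}|C_1\rangle v_l=b_lv_l$. For every initial environment state $\rho_E$ (a density matrix), put $$\alpha(t)=\sum_{k,l=1}^{d_E}\tfrac12\langle u_k|\rho_E|v_l\rangle\langle v_l|u_k\rangle\,e^{-it(a_k-b_l)} .$$ This exponential sum does not depend on $\omega$, and it satisfies $\alpha(0)=\frac12$ and $|\alpha(t)|\le\frac12$ for all $t$. Prepare $\rho_E\otimes|\psi\rangle\langle\psi|$ with $|\psi\rangle=\frac1{\sqrt2}(|C_0\rangle+|C_1\rangle)$, and during the time $t\ge0$ perform $N$ equally spaced syndrome measurements $\rho\mapsto P\rho P+(\mathbb 1-P)\rho(\mathbb 1-P)$ on probe and auxiliary system. As $N\to\infty$ the joint state converges to a density matrix $\rho(\omega,t)$. The reduced state $\rho_{PA}(\omega,t)=\operatorname{Tr}_E\rho(\omega,t)$ is differentiable in $\omega$, and its quantum Fisher information about $\omega$, that is $$\mathcal F=2\sum_{\gamma_i+\gamma_j>0}\frac{|\langle\gamma_i|\partial_\omega\rho_{PA}|\gamma_j\rangle|^2}{\gamma_i+\gamma_j}$$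 with $\gamma_i,|\gamma_i\rangle$ the eigenvalues and an orthonormal eigenbasis of $\rho_{PA}$, equals $$\mathcal F(\omega,t)=4t^2(\Delta\lambda)^2|\alpha(t)|^2 .$$ The envelope $4(\Delta\lambda)^2|\alpha(t)|^2$ is a (Bohr) almost periodic function of $t$. For every $\omega$, $$\limsup_{t\to\infty}\frac{\mathcal F(\omega,t)}{t^2}=(\Delta\lambda)^2>0,$$ and there are times $\tau_m\to\infty$, independent of $\omega$, with $\mathcal F(\omega,\tau_m)/\tau_m^2\to(\Delta\lambda)^2$. -/

import Mathlib

open Matrix Filter Topology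
open scoped Kronecker ComplexOrder

noncomputable section

namespace HiddenMarkov

/-! The index types `E`, `P`, `A` label orthonormal bases of the Hilbert spaces of the environment,
the probe and the noiseless auxiliary system. Joint operators are matrices over `E × (P × A)`. -/

section General

variable {n : Type*} [Fintype n] [DecidableEq n]

/-- Density matrices. -/
def IsDensity (ρ : Matrix n n ℂ) : Prop := ρ.PosSemidef ∧ ρ.trace = 1

/-- The rank-one operator `|v⟩⟨v|`. -/
def ketBra (v : n → ℂ) : Matrix n n ℂ := vecMulVec v (star v)

/-- Time evolution `e^{-itH} ρ e^{itH}` generated by the Hamiltonian `H`. -/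
def evolve (H : Matrix n n ℂ) (t : ℝ) (ρ : Matrix n n ℂ) : Matrix n n ℂ :=
  NormedSpace.exp (-(Complex.I * (t : ℂ)) • H) * ρ * NormedSpace.exp ((Complex.I * (t : ℂ)) • H)

attribute [local instance] Matrix.linftyOpNormedRing Matrix.linftyOpNormedAlgebra in
/-- `evolve` solves the master equation `dρ/dt = -i [H, ρ]`. -/
theorem evolve_masterEquation (H ρ : Matrix n n ℂ) (t : ℝ) (i j : n) :
    HasDerivAt (fun s : ℝ => evolve H s ρ i j)
      ((-Complex.I • (H * evolve H t ρ - evolve H t ρ * H)) i j) t := by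
  have e1 : ∀ s : ℝ, -(Complex.I * (s : ℂ)) • H = s • (-Complex.I • H) := by
    intro s; ext a b; simp; ring
  have e2 : ∀ s : ℝ, (Complex.I * (s : ℂ)) • H = s • (Complex.I • H) := by
    intro s; ext a b; simp; ring
  have h1 := hasDerivAt_exp_smul_const' (𝕂 := ℝ) (-Complex.I • H) t
  have h2 := hasDerivAt_exp_smul_const (𝕂 := ℝ) (Complex.I • H) t
  have h3 := (h1.mul_const ρ).mul h2
  have h4 := (Matrix.entryLinearMap ℝ ℂ i j).toContinuousLinearMap.hasFDerivAt.comp_hasDerivAt t h3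
  have e3 : (fun s : ℝ => evolve H s ρ i j) =
      (Matrix.entryLinearMap ℝ ℂ i j).toContinuousLinearMap ∘
        ((fun u : ℝ => NormedSpace.exp (u • (-Complex.I • H)) * ρ) *
          fun u : ℝ => NormedSpace.exp (u • (Complex.I • H))) := by
    funext s
    simp only [evolve, e1, e2]
    rfl
  rw [e3]
  refine h4.congr_deriv ?_
  have e4 : -Complex.I • H * NormedSpace.exp (t • -Complex.I • H) * ρ *
        NormedSpace.exp (t • Complex.I • H) + NormedSpace.exp (t • -Complex.I • H) * ρ *
        (NormedSpace.exp (t • Complex.I • H) * Complex.I • H) =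
      -Complex.I • (H * evolve H t ρ - evolve H t ρ * H) := by
    simp only [evolve, e1, e2, Matrix.smul_mul, Matrix.mul_smul, Matrix.mul_assoc, smul_sub]
    simp only [neg_smul, sub_neg_eq_add]
  rw [← e4]
  rfl

/-- Quantum Fisher information at `ω` of a differentiable family of density matrices:
`2 ∑_{γᵢ + γⱼ > 0} |⟨γᵢ| ∂_ω ρ |γⱼ⟩|² / (γᵢ + γⱼ)`, where the `|γᵢ⟩` form an orthonormal eigenbasis
of `ρ ω` with eigenvalues `γᵢ`. -/
def qfi (ρ : ℝ → Matrix n n ℂ) (ω : ℝ) : ℝ :=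
  if h : (ρ ω).IsHermitian then
    2 * ∑ i, ∑ j,
      if 0 < h.eigenvalues i + h.eigenvalues j then
        ‖star (h.eigenvectorBasis i).ofLp ⬝ᵥ
            ((Matrix.of fun a b => deriv (fun w => ρ w a b) ω) *ᵥ (h.eigenvectorBasis j).ofLp)‖ ^ 2
          / (h.eigenvalues i + h.eigenvalues j)
      else 0
  else 0

end General

/-- Bohr almost periodicity: for every `ε` the `ε`-almost periods are relatively dense. -/
def IsAlmostPeriodic (f : ℝ → ℝ) : Prop :=
  Continuous f ∧ ∀ ε > 0, ∃ L > 0, ∀ a : ℝ, ∃ τ ∈ Set.Icc a (a + L), ∀ t, |f (t + τ) - f t| ≤ ε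

variable {E P A : Type*} [Fintype E] [DecidableEq E] [Fintype P] [DecidableEq P]
  [Fintype A] [DecidableEq A]

/-- Partial trace over the first tensor factor. -/
def traceFst (ρ : Matrix (E × P) (E × P) ℂ) : Matrix P P ℂ :=
  Matrix.of fun x y => ∑ e, ρ (e, x) (e, y)

/-- Partial trace over the second tensor factor. -/
def traceSnd (ρ : Matrix (E × P) (E × P) ℂ) : Matrix E E ℂ :=
  Matrix.of fun x y => ∑ p, ρ (x, p) (y, p)

/-- An operator on environment and probe, extended trivially to the auxiliary system. -/
def extend (B : Matrix (E × P) (E × P) ℂ) : Matrix (E × (P × A)) (E × (P × A)) ℂ :=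
  Matrix.reindex (Equiv.prodAssoc E P A) (Equiv.prodAssoc E P A) (B ⊗ₖ (1 : Matrix A A ℂ))

/-- The total Hamiltonian `H_EP + ω (1_E ⊗ G ⊗ 1_A)`. -/
def hamiltonian (HEP : Matrix (E × P) (E × P) ℂ) (G : Matrix P P ℂ) (ω : ℝ) :
    Matrix (E × (P × A)) (E × (P × A)) ℂ :=
  extend HEP + (ω : ℂ) • extend ((1 : Matrix E E ℂ) ⊗ₖ G)

/-- The code words `C₀`, `C₁` are purifications, with orthogonal supports on the auxiliary system,
of the normalized positive and negative parts of the traceless part of `G`. -/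
structure IsSignalCode (G : Matrix P P ℂ) (C₀ C₁ : P × A → ℂ) : Prop where
  norm₀ : star C₀ ⬝ᵥ C₀ = 1
  norm₁ : star C₁ ⬝ᵥ C₁ = 1
  probe_orthogonal : traceSnd (ketBra C₀) * traceSnd (ketBra C₁) = 0
  aux_orthogonal : traceFst (ketBra C₀) * traceFst (ketBra C₁) = 0
  signal : ∃ c : ℝ, 0 < c ∧
    G - (G.trace / (Fintype.card P : ℂ)) • (1 : Matrix P P ℂ) =
      (c : ℂ) • (traceSnd (ketBra C₀) - traceSnd (ketBra C₁))

/-- The projector `|C₀⟩⟨C₀| + |C₁⟩⟨C₁|` onto the code space. -/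
def codeProj (C₀ C₁ : P × A → ℂ) : Matrix (P × A) (P × A) ℂ := ketBra C₀ + ketBra C₁

/-- The non-selective syndrome measurement `ρ ↦ Π ρ Π + Π_⊥ ρ Π_⊥`, where `Π` is the code
projector acting on probe and auxiliary system. -/
def syndrome (C₀ C₁ : P × A → ℂ) (ρ : Matrix (E × (P × A)) (E × (P × A)) ℂ) :
    Matrix (E × (P × A)) (E × (P × A)) ℂ :=
  ((1 : Matrix E E ℂ) ⊗ₖ codeProj C₀ C₁) * ρ * ((1 : Matrix E E ℂ) ⊗ₖ codeProj C₀ C₁) +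
    (1 - (1 : Matrix E E ℂ) ⊗ₖ codeProj C₀ C₁) * ρ * (1 - (1 : Matrix E E ℂ) ⊗ₖ codeProj C₀ C₁)

/-- The joint state at time `t` when `N` equally spaced syndrome measurements are made, starting from
`ρE ⊗ |ψ⟩⟨ψ|` with `ψ = (C₀ + C₁)/√2`. -/
def protocolState (HEP : Matrix (E × P) (E × P) ℂ) (G : Matrix P P ℂ) (C₀ C₁ : P × A → ℂ)
    (ρE : Matrix E E ℂ) (ω t : ℝ) (N : ℕ) : Matrix (E × (P × A)) (E × (P × A)) ℂ :=
  (fun ρ => syndrome C₀ C₁ (evolve (hamiltonian HEP G ω) (t / N) ρ))^[N]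
    (ρE ⊗ₖ ketBra (((1 / Real.sqrt 2 : ℝ) : ℂ) • (C₀ + C₁)))

/-- The environment operator `⟨C| H_EP |C⟩`. -/
def envBlock (HEP : Matrix (E × P) (E × P) ℂ) (C : P × A → ℂ) : Matrix E E ℂ :=
  Matrix.of fun e f => ∑ x, ∑ y, star (C x) * extend HEP (e, x) (f, y) * C y

/-- The exponential sum
`∑_{k,l} ½ ⟨u_k|ρE|v_l⟩⟨v_l|u_k⟩ e^{-it(a_k - b_l)}`. -/
def expSum (ρE : Matrix E E ℂ) (u v : OrthonormalBasis E ℂ (EuclideanSpace ℂ E)) (a b : E → ℝ)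
    (t : ℝ) : ℂ :=
  ∑ k, ∑ l, (1 / 2 : ℂ) * (star (u k).ofLp ⬝ᵥ (ρE *ᵥ (v l).ofLp)) *
    (star (v l).ofLp ⬝ᵥ (u k).ofLp) * Complex.exp (-(Complex.I * (t * (a k - b l) : ℝ)))

end HiddenMarkov

end

namespace HiddenMarkov

/-! ### The quantum Zeno limit in a normed algebra. -/

section Zeno

/-! Diagonalise the traceless part of `G` with eigenvectors `uₐ` and eigenvalues `gₐ`. Its positive
and negative parts have the same trace `c`; purify them, divided by `c`, as `∑ √(gₐ⁺/c) uₐ ⊗ eₐ` and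
`∑ √(gₐ⁻/c) uₐ ⊗ eₐ`. The two sums use disjoint sets of auxiliary basis vectors, so an operator
acting trivially on the auxiliary system has no matrix element between the code words
(`embed_extend_embed_eq_zero`). The noise can therefore act inside each code branch but can never
flip one into the other. The signal does distinguish them, because `λ₀ - λ₁ = ∑ gₐ² / c > 0`
(`exists_signalCode`).

Frequent syndrome measurements replace the Hamiltonian by its pinching (`tendsto_zeno`). On the
branch of `Cᵢ` the pinched Hamiltonian is `Bᵢ + ω λᵢ` with `Bᵢ = ⟨Cᵢ|H_EP|Cᵢ⟩`, and `ω` contributes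
only a scalar phase. Tracing out the environment leaves a qubit state with populations `½` and
off-diagonal entry `e^{-itωΔλ} α(t)`, where `α(t) = ½ Tr(e^{-itB₀} ρE e^{itB₁})`
(`traceFst_limitState`). Expanding this trace in eigenbases of `B₀` and `B₁` gives the exponential
sum (`expSum_eq_coherence`).

As `ω` varies the off-diagonal entry only rotates, so the derivative `D` of the state `ρ` satisfies
`ρD + Dρ = D`. Every denominator that matters in the Fisher information is then `1`, and the
information is `2 Tr D†D` (`qfi_of_anticommutator`, `qfi_signalState`). Positivity of the reduced
state gives `|α| ≤ ½`. Finitely many frequencies have common almost periods, by compactness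
(`exists_common_almostPeriod`), so the envelope returns arbitrarily late to values close to its
value at time `0`, which is also its maximum. This yields both the limsup and the times `τ_m`. -/

theorem norm_pow_sub_pow_le {S : Type*} [NormedRing S] (hone : ‖(1 : S)‖ ≤ 1) {a b : S} {M : ℝ}
    (hM : 1 ≤ M) (ha : ‖a‖ ≤ M) (hb : ‖b‖ ≤ M) (k : ℕ) :
    ‖a ^ k - b ^ k‖ ≤ k * M ^ k * ‖a - b‖ := by
  have hM0 : 0 ≤ M := zero_le_one.trans hM
  have hpow : ∀ k : ℕ, ‖a ^ k‖ ≤ M ^ k := by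
    intro k
    induction k with
    | zero => simpa using hone
    | succ k ih =>
      rw [pow_succ, pow_succ]
      exact (norm_mul_le _ _).trans (mul_le_mul ih ha (norm_nonneg _) (by positivity))
  induction k with
  | zero => simp
  | succ k ih =>
    have e : a ^ (k + 1) - b ^ (k + 1) = a ^ k * (a - b) + (a ^ k - b ^ k) * b := by
      rw [pow_succ, pow_succ]; noncomm_ring
    have h1 : ‖a ^ k * (a - b)‖ ≤ M ^ k * ‖a - b‖ :=
      (norm_mul_le _ _).trans (mul_le_mul_of_nonneg_right (hpow k) (norm_nonneg _))
    have h2 : ‖(a ^ k - b ^ k) * b‖ ≤ k * M ^ k * ‖a - b‖ * M :=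
      (norm_mul_le _ _).trans (mul_le_mul ih hb (norm_nonneg _) (by positivity))
    have h3 : M ^ k * ‖a - b‖ ≤ M ^ k * ‖a - b‖ * M :=
      le_mul_of_one_le_right (by positivity) hM
    rw [e]
    refine (norm_add_le _ _).trans ?_
    push_cast
    rw [pow_succ]
    nlinarith

/-- Chernoff-type comparison: two curves through `1` with the same velocity have the same
product limits. -/
theorem tendsto_pow_sub_pow {S : Type*} [NormedRing S] [NormedAlgebra ℝ S]
    (hone : ‖(1 : S)‖ ≤ 1) {a b : ℝ → S} {X : S} (ha0 : a 0 = 1) (hb0 : b 0 = 1)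
    (ha : HasDerivAt a X 0) (hb : HasDerivAt b X 0) (t : ℝ) :
    Tendsto (fun N : ℕ => a (t / N) ^ N - b (t / N) ^ N) atTop (𝓝 0) := by
  have hlim : Tendsto (fun N : ℕ => t / (N : ℝ)) atTop (𝓝 0) :=
    tendsto_const_div_atTop_nhds_zero_nat t
  -- The first-order expansion at `0` bounds each factor by `1 + C/N`, so its `N`-th power stays
  -- below `e^C`; the extra `1` in `‖X‖ + 1` absorbs the remainder.
  have key : ∀ f : ℝ → S, f 0 = 1 → HasDerivAt f X 0 →
      ∀ᶠ N : ℕ in atTop, ‖f (t / N)‖ ≤ 1 + (‖X‖ + 1) * |t| / N := by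
    intro f hf0 hf
    have h1 := (hasDerivAt_iff_isLittleO.1 hf).def (c := 1) one_pos
    filter_upwards [hlim.eventually h1] with N hN
    simp only [sub_zero, hf0, one_mul] at hN
    have e : f (t / N) = (f (t / N) - 1 - (t / (N : ℝ)) • X) + 1 + (t / (N : ℝ)) • X := by abel
    have e2 : ‖t / (N : ℝ)‖ = |t| / N := by simp
    rw [e2] at hN
    rw [e]
    refine (norm_add₃_le).trans ?_
    rw [norm_smul, e2]
    have : (‖X‖ + 1) * |t| / N = |t| / N * ‖X‖ + |t| / N := by ring
    linarith
  have hd : (fun s : ℝ => a s - b s) =o[𝓝 0] fun s : ℝ => s := by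
    have h := (hasDerivAt_iff_isLittleO.1 ha).sub (hasDerivAt_iff_isLittleO.1 hb)
    simpa [ha0, hb0] using h
  -- The velocities cancel, so one step differs by `o(1/N)`, and `N` steps accumulate only `o(1)`.
  have hd2 : Tendsto (fun N : ℕ => (N : ℝ) * ‖a (t / N) - b (t / N)‖) atTop (𝓝 0) := by
    have h := (hd.comp_tendsto hlim).norm_left
    have h3 : (fun N : ℕ => (N : ℝ) * ‖a (t / N) - b (t / N)‖) =o[atTop]
        fun N : ℕ => (N : ℝ) * (t / N) := (Asymptotics.isBigO_refl _ _).mul_isLittleO h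
    refine (Asymptotics.isLittleO_one_iff ℝ).1 (h3.trans_isBigO
      (Asymptotics.IsBigO.of_bound |t| (Eventually.of_forall fun N => ?_)))
    rcases Nat.eq_zero_or_pos N with rfl | hN
    · simp
    · have : (N : ℝ) ≠ 0 := by positivity
      rw [mul_div_cancel₀ _ this]
      simp
  set C : ℝ := (‖X‖ + 1) * |t| with hC
  have hC0 : 0 ≤ C := by positivity
  refine squeeze_zero_norm' ?_ (by simpa using hd2.const_mul (Real.exp C))
  filter_upwards [key a ha0 ha, key b hb0 hb, eventually_gt_atTop 0] with N h1 h2 hN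
  have hN' : (0 : ℝ) < N := by exact_mod_cast hN
  have hM : (1 + C / N) ^ N ≤ Real.exp C := by
    calc (1 + C / N) ^ N ≤ Real.exp (C / N) ^ N := by
          gcongr
          rw [add_comm]
          exact Real.add_one_le_exp _
      _ = Real.exp C := by
          rw [← Real.exp_nat_mul, mul_div_cancel₀ _ hN'.ne']
  calc _ ≤ N * (1 + C / N) ^ N * ‖a (t / N) - b (t / N)‖ :=
        norm_pow_sub_pow_le hone (by have : 0 ≤ C / N := by positivity
                                     linarith) h1 h2 N
    _ ≤ N * Real.exp C * ‖a (t / N) - b (t / N)‖ := by gcongr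
    _ = _ := by ring

variable {R : Type*} [NormedRing R] [NormedAlgebra ℂ R]

/-- The superoperator `x ↦ e^{-iτh} x e^{iτh}`. -/
noncomputable def conjExp (h : R) (τ : ℝ) : R →L[ℝ] R :=
  ContinuousLinearMap.mulLeftRight ℝ R (NormedSpace.exp (-(Complex.I * (τ : ℂ)) • h))
    (NormedSpace.exp ((Complex.I * (τ : ℂ)) • h))

theorem conjExp_apply (h : R) (τ : ℝ) (x : R) :
    conjExp h τ x = NormedSpace.exp (-(Complex.I * (τ : ℂ)) • h) * x *
      NormedSpace.exp ((Complex.I * (τ : ℂ)) • h) := by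
  simp [conjExp, ContinuousLinearMap.mulLeftRight_apply]

/-- The pinching `x ↦ p x p + (1 - p) x (1 - p)`. -/
noncomputable def pinch (p : R) : R →L[ℝ] R :=
  ContinuousLinearMap.mulLeftRight ℝ R p p + ContinuousLinearMap.mulLeftRight ℝ R (1 - p) (1 - p)

theorem pinch_apply (p x : R) : pinch p x = p * x * p + (1 - p) * x * (1 - p) := by
  rw [pinch, _root_.add_apply, ContinuousLinearMap.mulLeftRight_apply,
    ContinuousLinearMap.mulLeftRight_apply]

theorem pinch_of_commute {p x : R} (hp : p * p = p) (hx : Commute p x) : pinch p x = x := by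
  rw [pinch_apply]
  have h : p * x = x * p := hx
  have e : p * x * p + (1 - p) * x * (1 - p) = x - p * x - x * p + p * x * p + p * x * p := by
    simp only [sub_mul, mul_sub, one_mul, mul_one]
    abel
  rw [e, h, mul_assoc, hp]
  abel

theorem commute_pinch {p : R} (hp : p * p = p) (x : R) : Commute p (pinch p x) := by
  rw [pinch_apply]
  have h1 : p * (1 - p) = 0 := by rw [mul_sub, hp, mul_one, sub_self]
  have h2 : (1 - p) * p = 0 := by rw [sub_mul, hp, one_mul, sub_self]
  change p * (p * x * p + (1 - p) * x * (1 - p)) = (p * x * p + (1 - p) * x * (1 - p)) * p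
  have e1 : p * (p * x * p + (1 - p) * x * (1 - p)) =
      (p * p) * x * p + (p * (1 - p)) * x * (1 - p) := by noncomm_ring
  have e2 : (p * x * p + (1 - p) * x * (1 - p)) * p =
      p * x * (p * p) + (1 - p) * x * ((1 - p) * p) := by
    simp only [add_mul, mul_assoc]
  rw [e1, e2, h1, h2, hp]
  simp

theorem pinch_pinch {p : R} (hp : p * p = p) (x : R) : pinch p (pinch p x) = pinch p x :=
  pinch_of_commute hp (commute_pinch hp x)

/-- Pinching is a bimodule map over the commutant of `p`. Hence pinching `[h, y]` with `y` in the
commutant gives `[pinch p h, y]`, which is how the pinched generator arises. -/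
theorem pinch_mul_of_commute {p z : R} (hz : Commute p z) (x : R) :
    pinch p (x * z) = pinch p x * z := by
  have h1 : p * z = z * p := hz
  have h2 : (1 - p) * z = z * (1 - p) := by rw [sub_mul, mul_sub, h1, one_mul, mul_one]
  simp only [pinch_apply, add_mul, mul_assoc, h1, h2]

theorem pinch_mul_of_commute' {p z : R} (hz : Commute p z) (x : R) :
    pinch p (z * x) = z * pinch p x := by
  have h1 : p * z = z * p := hz
  have h2 : (1 - p) * z = z * (1 - p) := by rw [sub_mul, mul_sub, h1, one_mul, mul_one]
  simp only [pinch_apply, mul_add, ← mul_assoc, h1, h2]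

theorem conjExp_zero (h : R) : conjExp h 0 = 1 := by
  ext x
  simp [conjExp_apply]

theorem hasDerivAt_conjExp [CompleteSpace R] (h : R) :
    HasDerivAt (conjExp h) (ContinuousLinearMap.mulLeftRight ℝ R (-Complex.I • h) 1 +
      ContinuousLinearMap.mulLeftRight ℝ R 1 (Complex.I • h)) 0 := by
  have e1 : ∀ s : ℝ, -(Complex.I * (s : ℂ)) • h = s • (-Complex.I • h) := by
    intro s
    rw [← Complex.coe_smul, smul_smul]; congr 1; ring
  have e2 : ∀ s : ℝ, (Complex.I * (s : ℂ)) • h = s • (Complex.I • h) := by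
    intro s
    rw [← Complex.coe_smul, smul_smul]; congr 1; ring
  have h1 := hasDerivAt_exp_smul_const' (𝕂 := ℝ) (-Complex.I • h) 0
  have h2 := hasDerivAt_exp_smul_const' (𝕂 := ℝ) (Complex.I • h) 0
  have h3 := (ContinuousLinearMap.mulLeftRight ℝ R).hasDerivAt_of_bilinear (fun _ => h1) (fun _ => h2)
  simp only [zero_smul, NormedSpace.exp_zero, mul_one] at h3
  have e3 : conjExp h = fun s : ℝ => ContinuousLinearMap.mulLeftRight ℝ R
      (NormedSpace.exp (s • (-Complex.I • h))) (NormedSpace.exp (s • (Complex.I • h))) := by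
    funext s
    simp only [conjExp, e1, e2]
  rw [e3, add_comm]
  exact h3

theorem commute_conjExp {p h x : R} (hp : Commute p h) (hx : Commute p x) (τ : ℝ) :
    Commute p (conjExp h τ x) := by
  have := NormedAlgebra.restrictScalars ℚ ℂ R
  rw [conjExp_apply]
  exact (((hp.smul_right _).exp_right).mul_right hx).mul_right ((hp.smul_right _).exp_right)

theorem conjExp_add [CompleteSpace R] (h : R) (s t : ℝ) (x : R) :
    conjExp h (s + t) x = conjExp h s (conjExp h t x) := by
  have := NormedAlgebra.restrictScalars ℚ ℂ R
  simp only [conjExp_apply]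
  have e1 : -(Complex.I * ((s + t : ℝ) : ℂ)) • h =
      -(Complex.I * (s : ℂ)) • h + -(Complex.I * (t : ℂ)) • h := by
    rw [← add_smul]; congr 1; push_cast; ring
  have e2 : (Complex.I * ((s + t : ℝ) : ℂ)) • h =
      (Complex.I * (t : ℂ)) • h + (Complex.I * (s : ℂ)) • h := by
    rw [← add_smul]; congr 1; push_cast; ring
  rw [e1, e2, NormedSpace.exp_add_of_commute, NormedSpace.exp_add_of_commute]
  · simp only [mul_assoc]
  · exact ((Commute.refl h).smul_left _).smul_right _
  · exact ((Commute.refl h).smul_left _).smul_right _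

/-- Quantum Zeno limit: frequent pinching replaces the generator by its pinched version. -/
theorem tendsto_zeno [CompleteSpace R] {p : R} (hp : p * p = p) (h : R) {x : R} (hx : Commute p x) (t : ℝ) :
    Tendsto (fun N : ℕ => (fun y => pinch p (conjExp h (t / N) y))^[N] x) atTop
      (𝓝 (conjExp (pinch p h) t x)) := by
  set D : R →L[ℝ] R := pinch p with hD
  have hDD : D * D = D := by
    ext y
    exact pinch_pinch hp y
  -- The summand `1 - D` makes this a curve through the identity, as the Chernoff comparison
  -- requires. It vanishes on pinched elements, so the iterates of interest are unchanged.
  set F : R → ℝ → R →L[ℝ] R := fun g τ => D * conjExp g τ * D + (1 - D) with hF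
  have hF0 : ∀ g, F g 0 = 1 := by
    intro g
    simp [hF, conjExp_zero, hDD]
  have hFd : ∀ g, HasDerivAt (F g) (D * (ContinuousLinearMap.mulLeftRight ℝ R (-Complex.I • g) 1 +
      ContinuousLinearMap.mulLeftRight ℝ R 1 (Complex.I • g)) * D) 0 := by
    intro g
    exact (((hasDerivAt_conjExp g).const_mul D).mul_const D).add_const (1 - D)
  have hX : D * (ContinuousLinearMap.mulLeftRight ℝ R (-Complex.I • h) 1 +
        ContinuousLinearMap.mulLeftRight ℝ R 1 (Complex.I • h)) * D =
      D * (ContinuousLinearMap.mulLeftRight ℝ R (-Complex.I • D h) 1 +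
        ContinuousLinearMap.mulLeftRight ℝ R 1 (Complex.I • D h)) * D := by
    ext y
    have hy : Commute p (pinch p y) := commute_pinch hp y
    change D (ContinuousLinearMap.mulLeftRight ℝ R (-Complex.I • h) 1 (D y) +
        ContinuousLinearMap.mulLeftRight ℝ R 1 (Complex.I • h) (D y)) =
      D (ContinuousLinearMap.mulLeftRight ℝ R (-Complex.I • D h) 1 (D y) +
        ContinuousLinearMap.mulLeftRight ℝ R 1 (Complex.I • D h) (D y))
    have hs : ∀ (c : ℂ) (z : R), D (c • z) = c • D z := by
      intro c z
      simp [hD, pinch_apply]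
    simp only [ContinuousLinearMap.mulLeftRight_apply, mul_one, one_mul, smul_mul_assoc,
      mul_smul_comm, map_add, hs]
    simp only [hD, pinch_mul_of_commute hy, pinch_mul_of_commute' hy, pinch_pinch hp]
  have hlim := tendsto_pow_sub_pow (S := R →L[ℝ] R) ContinuousLinearMap.norm_id_le (hF0 h)
    (hF0 (D h)) (hFd h) (hX ▸ hFd (D h)) t
  have hlim2 : Tendsto (fun N : ℕ => (F h (t / N) ^ N - F (D h) (t / N) ^ N) x) atTop (𝓝 0) := by
    have := ((ContinuousLinearMap.apply ℝ R x).continuous.tendsto _).comp hlim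
    rwa [map_zero] at this
  have hFapp : ∀ g τ y, Commute p y → F g τ y = D (conjExp g τ y) := by
    intro g τ y hy
    have : D y = y := pinch_of_commute hp hy
    simp [hF, this]
  have hA : ∀ (N : ℕ) (τ : ℝ), (fun y => pinch p (conjExp h τ y))^[N] x = (F h τ ^ N) x ∧
      Commute p ((F h τ ^ N) x) := by
    intro N τ
    induction N with
    | zero => simpa using hx
    | succ k ih =>
      rw [Function.iterate_succ_apply', ih.1, pow_succ']
      change _ = F h τ ((F h τ ^ k) x) ∧ Commute p (F h τ ((F h τ ^ k) x))
      rw [hFapp h τ _ ih.2]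
      exact ⟨rfl, commute_pinch hp _⟩
  -- The evolution generated by `D h` preserves the commutant of `p`, where pinching does nothing,
  -- so the powers form an exact one-parameter group.
  have hB : ∀ (N : ℕ) (τ : ℝ), (F (D h) τ ^ N) x = conjExp (D h) (N * τ) x := by
    intro N τ
    induction N with
    | zero => simp [conjExp_zero]
    | succ k ih =>
      rw [pow_succ']
      change F (D h) τ ((F (D h) τ ^ k) x) = _
      have hc := commute_conjExp (commute_pinch hp h) hx (k * τ)
      rw [ih, hFapp _ _ _ hc, ← conjExp_add]
      have : τ + k * τ = ((k + 1 : ℕ) : ℝ) * τ := by push_cast; ring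
      rw [this]
      exact pinch_of_commute hp (commute_conjExp (commute_pinch hp h) hx _)
  have h3 := hlim2.add_const (conjExp (D h) t x)
  rw [zero_add] at h3
  refine h3.congr' ?_
  filter_upwards [eventually_gt_atTop 0] with N hN
  have hN' : (N : ℝ) ≠ 0 := by positivity
  rw [(hA N _).1, _root_.sub_apply, hB, mul_div_cancel₀ _ hN']
  abel

end Zeno

/-! ### Environment blocks of joint operators. -/

section Embedding

set_option linter.unusedSectionVars false

variable {E S P A : Type*} [Fintype E] [DecidableEq E] [Fintype S] [DecidableEq S]
  [Fintype P] [DecidableEq P] [Fintype A] [DecidableEq A]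

/-- The operator `x ↦ x ⊗ C` that appends the vector `C`. -/
def embed (E : Type*) [DecidableEq E] {S : Type*} (C : S → ℂ) : Matrix (E × S) E ℂ :=
  Matrix.of fun p f => if p.1 = f then C p.2 else 0

theorem embed_conjTranspose_mul_mul_embed_apply (C D : S → ℂ) (M : Matrix (E × S) (E × S) ℂ)
    (e f : E) :
    ((embed E C)ᴴ * M * embed E D) e f = ∑ x, ∑ y, star (C x) * M (e, x) (f, y) * D y := by
  have h1 : ∀ z : E × S, ((embed E C)ᴴ * M) e z = ∑ x, star (C x) * M (e, x) z := by
    intro z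
    simp only [mul_apply, Fintype.sum_prod_type, embed, conjTranspose_apply, of_apply]
    rw [Finset.sum_eq_single e]
    · simp
    · intro b _ hb
      simp [hb]
    · simp
  rw [Matrix.mul_apply]
  simp only [Fintype.sum_prod_type, h1]
  rw [Finset.sum_eq_single f]
  · simp only [embed, of_apply, if_true, Finset.sum_mul]
    exact Finset.sum_comm
  · intro b _ hb
    simp [embed, hb]
  · simp

theorem embed_conjTranspose_mul_embed (C D : S → ℂ) :
    (embed E C)ᴴ * embed E D = (star C ⬝ᵥ D) • (1 : Matrix E E ℂ) := by
  ext e f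
  have h := embed_conjTranspose_mul_mul_embed_apply (E := E) C D 1 e f
  rw [Matrix.mul_one] at h
  rw [h]
  by_cases hef : e = f
  · subst hef
    simp [one_apply, dotProduct]
  · simp [one_apply, hef]

theorem embed_mul_mul_embed_conjTranspose (C D : S → ℂ) (X : Matrix E E ℂ) :
    embed E C * X * (embed E D)ᴴ = X ⊗ₖ vecMulVec C (star D) := by
  ext ⟨e, x⟩ ⟨f, y⟩
  simp [mul_apply, embed, vecMulVec_apply, kroneckerMap_apply, apply_ite]
  ring

theorem one_kronecker_ketBra (C : S → ℂ) :
    (1 : Matrix E E ℂ) ⊗ₖ ketBra C = embed E C * (embed E C)ᴴ := by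
  rw [ketBra, ← embed_mul_mul_embed_conjTranspose, Matrix.mul_one]

theorem traceFst_embed_mul_mul (C D : S → ℂ) (X : Matrix E E ℂ) :
    traceFst (embed E C * X * (embed E D)ᴴ) = X.trace • vecMulVec C (star D) := by
  ext x y
  simp [embed_mul_mul_embed_conjTranspose, traceFst, kroneckerMap_apply, trace, Finset.sum_mul]

theorem envBlock_eq (B : Matrix (E × P) (E × P) ℂ) (C : P × A → ℂ) :
    envBlock B C = (embed E C)ᴴ * extend (A := A) B * embed E C := by
  ext e f
  rw [embed_conjTranspose_mul_mul_embed_apply]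
  rfl

/-- An operator trivial on the auxiliary system sees `C` and `D` only through their partial inner
products over that system. This is the error-correcting property of the code and holds for every
noise operator. -/
theorem embed_extend_embed_eq_zero {C D : P × A → ℂ}
    (h : ∀ p q, ∑ a, star (C (p, a)) * D (q, a) = 0) (B : Matrix (E × P) (E × P) ℂ) :
    (embed E C)ᴴ * extend (A := A) B * embed E D = 0 := by
  ext e f
  rw [embed_conjTranspose_mul_mul_embed_apply]
  have h1 : ∀ p q, ∑ a, ∑ b, star (C (p, a)) * extend (A := A) B (e, (p, a)) (f, (q, b)) * D (q, b)
      = 0 := by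
    intro p q
    have : ∀ a b, star (C (p, a)) * extend (A := A) B (e, (p, a)) (f, (q, b)) * D (q, b) =
        if a = b then B (e, p) (f, q) * (star (C (p, a)) * D (q, a)) else 0 := by
      intro a b
      simp only [extend, reindex_apply, submatrix_apply, kroneckerMap_apply,
        Equiv.prodAssoc_symm_apply, one_apply]
      split_ifs with hab
      · subst hab; ring
      · ring
    simp only [this, Finset.sum_ite_eq, Finset.mem_univ, if_true]
    rw [← Finset.mul_sum, h, mul_zero]
  simp only [Fintype.sum_prod_type]
  refine Finset.sum_eq_zero fun p _ => ?_
  rw [Finset.sum_comm]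
  exact Finset.sum_eq_zero fun q _ => h1 p q

theorem extend_one_kronecker (G : Matrix P P ℂ) :
    extend (A := A) ((1 : Matrix E E ℂ) ⊗ₖ G) = (1 : Matrix E E ℂ) ⊗ₖ (G ⊗ₖ (1 : Matrix A A ℂ)) := by
  ext ⟨e, p, a⟩ ⟨f, q, b⟩
  simp [extend, kroneckerMap_apply, mul_assoc]

theorem embed_one_kronecker_embed (C D : S → ℂ) (M : Matrix S S ℂ) :
    (embed E C)ᴴ * ((1 : Matrix E E ℂ) ⊗ₖ M) * embed E D =
      (star C ⬝ᵥ (M *ᵥ D)) • (1 : Matrix E E ℂ) := by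
  ext e f
  rw [embed_conjTranspose_mul_mul_embed_apply]
  by_cases hef : e = f
  · subst hef
    simp [one_apply, dotProduct, kroneckerMap_apply, mulVec, Finset.mul_sum, mul_assoc]
  · simp [one_apply, hef, kroneckerMap_apply]

theorem isHermitian_extend {B : Matrix (E × P) (E × P) ℂ} (hB : B.IsHermitian) :
    (extend (A := A) B).IsHermitian := by
  ext ⟨e, p, a⟩ ⟨f, q, b⟩
  have := congrFun (congrFun hB (e, p)) (f, q)
  simp only [conjTranspose_apply] at this
  simp only [extend, reindex_apply, conjTranspose_apply, submatrix_apply, kroneckerMap_apply,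
    Equiv.prodAssoc_symm_apply, star_mul', this, one_apply, eq_comm (a := a)]
  split_ifs <;> simp

theorem isHermitian_one_kronecker {G : Matrix P P ℂ} (hG : G.IsHermitian) :
    ((1 : Matrix E E ℂ) ⊗ₖ G).IsHermitian := by
  rw [IsHermitian, conjTranspose_kronecker, hG, conjTranspose_one]

attribute [local instance] Matrix.linftyOpNormedRing Matrix.linftyOpNormedAlgebra in
-- Each power intertwines, and multiplication by `W` passes through the exponential series. Since
-- `W` is rectangular, this transfers a propagator from the joint space to the environment.
theorem exp_mul_of_intertwines {m n : Type*} [Fintype m] [DecidableEq m] [Fintype n] [DecidableEq n]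
    {K : Matrix m m ℂ} {W : Matrix m n ℂ} {B : Matrix n n ℂ} (h : K * W = W * B) :
    NormedSpace.exp K * W = W * NormedSpace.exp B := by
  have hpow : ∀ k : ℕ, K ^ k * W = W * B ^ k := by
    intro k
    induction k with
    | zero => simp
    | succ k ih => rw [pow_succ, Matrix.mul_assoc, h, ← Matrix.mul_assoc, ih, Matrix.mul_assoc,
        ← pow_succ]
  have h1 := (NormedSpace.exp_series_hasSum_exp' (𝕂 := ℂ) K).map
    (AddMonoidHom.mk' (fun X : Matrix m m ℂ => X * W) fun X Y => Matrix.add_mul X Y W)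
    (continuous_id.matrix_mul continuous_const)
  have h2 := (NormedSpace.exp_series_hasSum_exp' (𝕂 := ℂ) B).map
    (AddMonoidHom.mk' (fun X : Matrix n n ℂ => W * X) fun X Y => Matrix.mul_add W X Y)
    (continuous_const.matrix_mul continuous_id)
  refine h1.unique ?_
  have : (AddMonoidHom.mk' (fun X : Matrix m m ℂ => X * W) fun X Y => Matrix.add_mul X Y W) ∘
      (fun k : ℕ => ((k.factorial : ℂ)⁻¹) • K ^ k) =
      (AddMonoidHom.mk' (fun X : Matrix n n ℂ => W * X) fun X Y => Matrix.mul_add W X Y) ∘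
      (fun k : ℕ => ((k.factorial : ℂ)⁻¹) • B ^ k) := by
    funext k
    simp [hpow]
  rw [this]
  exact h2

end Embedding

/-! ### Fisher information of the dephased qubit state. -/

section SignalState

set_option linter.unusedSectionVars false

variable {n : Type*} [Fintype n] [DecidableEq n]

/-- The eigenvector unitary intertwines a Hermitian matrix with its diagonal form. -/
theorem mul_eigenvectorUnitary {B : Matrix n n ℂ} (hB : B.IsHermitian) :
    B * (hB.eigenvectorUnitary : Matrix n n ℂ) =
      (hB.eigenvectorUnitary : Matrix n n ℂ) * diagonal fun i => (hB.eigenvalues i : ℂ) := by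
  ext a j
  have := congrFun (hB.mulVec_eigenvectorBasis j) a
  rw [mul_diagonal]
  simp only [Pi.smul_apply, Complex.real_smul] at this
  rw [mul_comm]
  exact this

/-- For a derivative `D` with `ρ D + D ρ = D`, the quantum Fisher information is `2 Tr (D† D)`. -/
theorem qfi_of_anticommutator {ρ : ℝ → Matrix n n ℂ} {ω : ℝ} {D : Matrix n n ℂ}
    (hder : ∀ a b, HasDerivAt (fun w => ρ w a b) (D a b) ω) (hH : (ρ ω).IsHermitian)
    (hD : ρ ω * D + D * ρ ω = D) : ((qfi ρ ω : ℝ) : ℂ) = 2 * (Dᴴ * D).trace := by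
  have hof : (Matrix.of fun a b => deriv (fun w => ρ w a b) ω) = D := by
    ext a b
    exact (hder a b).deriv
  set U : Matrix n n ℂ := (hH.eigenvectorUnitary : Matrix n n ℂ) with hU
  set γ := hH.eigenvalues with hγ
  have hUU : U * Uᴴ = 1 := Unitary.coe_mul_star_self hH.eigenvectorUnitary
  have hUU' : Uᴴ * U = 1 := Unitary.coe_star_mul_self hH.eigenvectorUnitary
  have hspec : ρ ω * U = U * diagonal (fun i => (γ i : ℂ)) :=
    mul_eigenvectorUnitary hH
  have hspec' : Uᴴ * ρ ω = diagonal (fun i => (γ i : ℂ)) * Uᴴ := by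
    have h := congrArg conjTranspose hspec
    rw [conjTranspose_mul, conjTranspose_mul, hH, diagonal_conjTranspose] at h
    rw [h]
    congr 2
    funext i
    simp
  set X : Matrix n n ℂ := Uᴴ * D * U with hX
  have hent : ∀ i j, star (hH.eigenvectorBasis i).ofLp ⬝ᵥ (D *ᵥ (hH.eigenvectorBasis j).ofLp)
      = X i j := by
    intro i j
    rw [hX, Matrix.mul_assoc, Matrix.mul_apply]
    rfl
  have hXX : diagonal (fun i => (γ i : ℂ)) * X + X * diagonal (fun i => (γ i : ℂ)) = X := by
    calc _ = Uᴴ * (ρ ω * D + D * ρ ω) * U := by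
          simp only [hX, Matrix.mul_add, Matrix.add_mul]
          rw [← Matrix.mul_assoc Uᴴ (ρ ω), hspec']
          simp only [Matrix.mul_assoc]
          rw [hspec]
      _ = X := by rw [hD]
  -- In the eigenbasis the anticommutator identity reads `(γᵢ + γⱼ - 1) Xᵢⱼ = 0`: wherever `X` does
  -- not vanish the denominator is `1`, and elsewhere the term is zero on both sides.
  have hterm : ∀ i j, (if 0 < γ i + γ j then ‖X i j‖ ^ 2 / (γ i + γ j) else 0) = ‖X i j‖ ^ 2 := by
    intro i j
    have h := congrFun (congrFun hXX i) j
    rw [Matrix.add_apply, diagonal_mul, mul_diagonal] at h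
    have h2 : ((γ i + γ j : ℝ) - 1 : ℂ) * X i j = 0 := by
      push_cast
      linear_combination h
    rcases mul_eq_zero.1 h2 with h3 | h3
    · have h4 : γ i + γ j = 1 := by exact_mod_cast sub_eq_zero.1 h3
      rw [h4]; simp
    · rw [h3]; simp
  rw [qfi, dif_pos hH]
  simp only [hof, hent]
  simp only [← hγ, hterm]
  have htr : (Dᴴ * D).trace = (Xᴴ * X).trace := by
    have : Xᴴ * X = Uᴴ * (Dᴴ * D * U) := by
      simp only [hX, conjTranspose_mul, conjTranspose_conjTranspose, Matrix.mul_assoc]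
      rw [← Matrix.mul_assoc U Uᴴ, hUU, Matrix.one_mul]
    rw [this, trace_mul_comm Uᴴ, Matrix.mul_assoc, hUU, Matrix.mul_one]
  rw [htr]
  simp only [trace, diag_apply, Matrix.mul_apply, conjTranspose_apply]
  push_cast
  congr 1
  rw [Finset.sum_comm]
  refine Finset.sum_congr rfl fun i _ => Finset.sum_congr rfl fun j _ => ?_
  rw [← Complex.conj_mul']
  rfl

/-- The state `½ (|C₀⟩⟨C₀| + |C₁⟩⟨C₁|) + β |C₀⟩⟨C₁| + β̄ |C₁⟩⟨C₀|` of the code space. -/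
noncomputable def signalState (C₀ C₁ : n → ℂ) (β : ℂ) : Matrix n n ℂ :=
  (1 / 2 : ℂ) • (ketBra C₀ + ketBra C₁) +
    (β • vecMulVec C₀ (star C₁) + star β • vecMulVec C₁ (star C₀))

theorem vecMulVec_star_mul (a b c d : n → ℂ) :
    vecMulVec a (star b) * vecMulVec c (star d) = (star b ⬝ᵥ c) • vecMulVec a (star d) := by
  rw [vecMulVec_mul_vecMulVec, vecMulVec_smul]

theorem star_dotProduct_eq_zero_symm {a b : n → ℂ} (h : star a ⬝ᵥ b = 0) : star b ⬝ᵥ a = 0 := by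
  rw [star_dotProduct, h, star_zero]

variable {C₀ C₁ : n → ℂ}

theorem hasDerivAt_signalState {β : ℝ → ℂ} {d : ℂ} {ω : ℝ} (hβ : HasDerivAt β d ω) (a b : n) :
    HasDerivAt (fun w => signalState C₀ C₁ (β w) a b)
      ((d • vecMulVec C₀ (star C₁) + star d • vecMulVec C₁ (star C₀)) a b) ω := by
  have h1 := hβ.mul_const (vecMulVec C₀ (star C₁) a b)
  have h2 := hβ.star.mul_const (vecMulVec C₁ (star C₀) a b)
  exact (h1.add h2).const_add (((1 / 2 : ℂ) • (ketBra C₀ + ketBra C₁)) a b)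

/-- The hypothesis on the derivative says that `β` rotates without changing modulus. So the
off-diagonal part of the state anticommutes with `D`, while the part `½P` reproduces `D`. Moreover
`D²` is `|β'|²` times the code projector, of trace `2`, hence the factor `4`. -/
theorem qfi_signalState (h00 : star C₀ ⬝ᵥ C₀ = 1) (h11 : star C₁ ⬝ᵥ C₁ = 1)
    (h01 : star C₀ ⬝ᵥ C₁ = 0) {β : ℝ → ℂ} {ω c : ℝ}
    (hβ : HasDerivAt β (-(Complex.I * c) * β ω) ω) :
    qfi (fun w => signalState C₀ C₁ (β w)) ω = 4 * c ^ 2 * ‖β ω‖ ^ 2 := by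
  have h10 := star_dotProduct_eq_zero_symm h01
  set d : ℂ := -(Complex.I * c) * β ω with hd
  set D : Matrix n n ℂ := d • vecMulVec C₀ (star C₁) + star d • vecMulVec C₁ (star C₀) with hD
  have hder := hasDerivAt_signalState (C₀ := C₀) (C₁ := C₁) hβ
  have hDH : Dᴴ = D := by
    simp only [hD, conjTranspose_add, conjTranspose_smul, conjTranspose_vecMulVec, star_star]
    rw [add_comm]
  have hH : ∀ β : ℂ, (signalState C₀ C₁ β).IsHermitian := by
    intro β
    simp only [IsHermitian, signalState, ketBra, conjTranspose_add, conjTranspose_smul,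
      conjTranspose_vecMulVec, star_star]
    have : star (1 / 2 : ℂ) = 1 / 2 := by simp
    rw [this, add_comm (β • _)]
  have hanti : signalState C₀ C₁ (β ω) * D + D * signalState C₀ C₁ (β ω) = D := by
    have hre : β ω * star d + d * star (β ω) = 0 := by
      simp [hd]
      ring
    have hre' : star (β ω) * d + star d * β ω = 0 := by linear_combination hre
    simp only [signalState, ketBra, hD, Matrix.add_mul, Matrix.mul_add, smul_mul_assoc,
      mul_smul_comm, vecMulVec_star_mul, h00, h11, h01, h10, zero_smul, one_smul, smul_zero,
      zero_add, add_zero, smul_add]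
    ext a b
    simp only [Matrix.add_apply, Matrix.smul_apply, smul_eq_mul]
    linear_combination vecMulVec C₀ (star C₀) a b * hre + vecMulVec C₁ (star C₁) a b * hre'
  have htr : (Dᴴ * D).trace = 2 * (d * star d) := by
    rw [hDH]
    simp only [hD, Matrix.add_mul, Matrix.mul_add, smul_mul_assoc,
      mul_smul_comm, vecMulVec_star_mul, h00, h11, h01, h10, zero_smul, one_smul, smul_zero,
      zero_add, add_zero, trace_add, trace_smul, trace_vecMulVec, dotProduct_comm _ (star _), smul_eq_mul, mul_one]
    ring
  have h := qfi_of_anticommutator hder (hH (β ω)) hanti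
  rw [htr] at h
  have hdn : d * star d = ((c ^ 2 * ‖β ω‖ ^ 2 : ℝ) : ℂ) := by
    have : d * star d = ((‖d‖ ^ 2 : ℝ) : ℂ) := by
      push_cast
      exact Complex.mul_conj' d
    rw [this, hd]
    simp [mul_pow]
  rw [hdn] at h
  have h' : qfi (fun w => signalState C₀ C₁ (β w)) ω = 2 * (2 * (c ^ 2 * ‖β ω‖ ^ 2)) := by
    exact_mod_cast h
  rw [h']
  ring

theorem norm_le_of_posSemidef_signalState (h00 : star C₀ ⬝ᵥ C₀ = 1) (h11 : star C₁ ⬝ᵥ C₁ = 1)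
    (h01 : star C₀ ⬝ᵥ C₁ = 0) {β : ℂ} (h : (signalState C₀ C₁ β).PosSemidef) : ‖β‖ ≤ 1 / 2 := by
  have h10 := star_dotProduct_eq_zero_symm h01
  -- For `β ≠ 0` this test vector is an eigenvector with eigenvalue `½ - ‖β‖`.
  have key := h.dotProduct_mulVec_nonneg (β • C₀ - (‖β‖ : ℂ) • C₁)
  have e : star (β • C₀ - (‖β‖ : ℂ) • C₁) ⬝ᵥ
      (signalState C₀ C₁ β *ᵥ (β • C₀ - (‖β‖ : ℂ) • C₁)) =
      ((‖β‖ ^ 2 - 2 * ‖β‖ ^ 3 : ℝ) : ℂ) := by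
    have hb : β * (starRingEnd ℂ) β = (‖β‖ : ℂ) ^ 2 := Complex.mul_conj' β
    simp only [signalState, ketBra, add_mulVec, smul_mulVec, vecMulVec_mulVec, mulVec_sub,
      mulVec_smul, h00, h11, h01, h10, star_sub, star_smul, sub_dotProduct, smul_dotProduct,
      dotProduct_add, dotProduct_sub, dotProduct_smul, op_smul_eq_smul, smul_eq_mul]
    simp
    linear_combination (1 / 2 - 2 * (‖β‖ : ℂ)) * hb
  rw [e] at key
  have key' : 0 ≤ ‖β‖ ^ 2 - 2 * ‖β‖ ^ 3 := by exact_mod_cast key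
  by_contra hc
  push Not at hc
  have : 0 < ‖β‖ ^ 2 := by
    have : 0 < ‖β‖ := by linarith
    positivity
  nlinarith

theorem posSemidef_traceFst {E S : Type*} [Fintype E] [Fintype S]
    {ρ : Matrix (E × S) (E × S) ℂ} (h : ρ.PosSemidef) : (traceFst ρ).PosSemidef := by
  have : traceFst ρ = ∑ e, ρ.submatrix (Prod.mk e) (Prod.mk e) := by
    ext x y
    simp [traceFst, Matrix.sum_apply]
  rw [this]
  exact posSemidef_sum _ fun e _ => h.submatrix _

end SignalState

/-! ### The Zeno dynamics on the code space and the reduced limit state. -/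

section LimitState

set_option linter.unusedSectionVars false

variable {n m : Type*} [Fintype n] [DecidableEq n] [Fintype m] [DecidableEq m]

/-- On the range of `W₀` only the corner `p K p` acts, and with the cross block zero it cannot leave
that range. The range is thus invariant, and the pinched operator acts there as the compression `B`.
-/
theorem pinch_mul_isometry {W₀ W₁ : Matrix n m ℂ} {p K : Matrix n n ℂ} {B : Matrix m m ℂ}
    (hp : p = W₀ * W₀ᴴ + W₁ * W₁ᴴ) (h00 : W₀ᴴ * W₀ = 1) (h10 : W₁ᴴ * W₀ = 0)
    (hB : W₀ᴴ * K * W₀ = B) (hc : W₁ᴴ * K * W₀ = 0) :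
    (p * K * p + (1 - p) * K * (1 - p)) * W₀ = W₀ * B := by
  have hpW : p * W₀ = W₀ := by
    rw [hp, Matrix.add_mul, Matrix.mul_assoc, Matrix.mul_assoc, h00, h10, Matrix.mul_one,
      Matrix.mul_zero, add_zero]
  rw [Matrix.add_mul, Matrix.mul_assoc _ p, Matrix.mul_assoc _ (1 - p), Matrix.sub_mul 1 p W₀, hpW,
    Matrix.one_mul, sub_self, Matrix.mul_zero, add_zero, hp, Matrix.mul_assoc, Matrix.add_mul,
    Matrix.mul_assoc, Matrix.mul_assoc, ← Matrix.mul_assoc W₀ᴴ, hB, ← Matrix.mul_assoc W₁ᴴ, hc,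
    Matrix.mul_zero, add_zero]

/-- The unitary propagator `e^{-itB}`. -/
noncomputable def propagator (B : Matrix n n ℂ) (t : ℝ) : Matrix n n ℂ :=
  NormedSpace.exp (-(Complex.I * (t : ℂ)) • B)

theorem propagator_conjTranspose {B : Matrix n n ℂ} (hB : B.IsHermitian) (t : ℝ) :
    (propagator B t)ᴴ = NormedSpace.exp ((Complex.I * (t : ℂ)) • B) := by
  rw [propagator, ← Matrix.exp_conjTranspose, conjTranspose_smul, hB]
  congr 2
  simp

theorem evolve_eq_propagator {B : Matrix n n ℂ} (hB : B.IsHermitian) (t : ℝ) (ρ : Matrix n n ℂ) :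
    evolve B t ρ = propagator B t * ρ * (propagator B t)ᴴ := by
  rw [propagator_conjTranspose hB]
  rfl

theorem propagator_conjTranspose_mul_self {B : Matrix n n ℂ} (hB : B.IsHermitian) (t : ℝ) :
    (propagator B t)ᴴ * propagator B t = 1 := by
  have hc : Commute ((Complex.I * (t : ℂ)) • B) (-((Complex.I * (t : ℂ)) • B)) :=
    (Commute.refl _).neg_right
  rw [propagator_conjTranspose hB, propagator, neg_smul, ← Matrix.exp_add_of_commute _ _ hc,
    add_neg_cancel, NormedSpace.exp_zero]

theorem propagator_mul_of_intertwines {K : Matrix n n ℂ} {W : Matrix n m ℂ} {B : Matrix m m ℂ}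
    (h : K * W = W * B) (t : ℝ) : propagator K t * W = W * propagator B t :=
  exp_mul_of_intertwines (by rw [Matrix.smul_mul, h, Matrix.mul_smul])

theorem propagator_diagonal (a : n → ℝ) (t : ℝ) :
    propagator (diagonal fun i => (a i : ℂ)) t =
      diagonal fun i => Complex.exp (-(Complex.I * (t * a i : ℝ))) := by
  rw [propagator, ← diagonal_smul, Matrix.exp_diagonal]
  congr 1
  funext i
  rw [Pi.coe_exp]
  simp [← Complex.exp_eq_exp_ℂ, mul_assoc]

theorem propagator_add_smul_one (B : Matrix n n ℂ) (c t : ℝ) :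
    propagator (B + (c : ℂ) • 1) t = Complex.exp (-(Complex.I * (t * c : ℝ))) • propagator B t := by
  have h : (c : ℂ) • (1 : Matrix n n ℂ) = diagonal fun _ => (c : ℂ) := by
    rw [smul_one_eq_diagonal]
  have hd : propagator ((c : ℂ) • (1 : Matrix n n ℂ)) t =
      Complex.exp (-(Complex.I * (t * c : ℝ))) • 1 := by
    rw [h, propagator_diagonal (fun _ => c), smul_one_eq_diagonal]
  rw [propagator, smul_add, Matrix.exp_add_of_commute]
  · change propagator B t * propagator ((c : ℂ) • 1) t = _
    rw [hd, Matrix.mul_smul, Matrix.mul_one]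
  · exact (((Commute.one_right B).smul_right _).smul_right _).smul_left _

variable {E P A : Type*} [Fintype E] [DecidableEq E] [Fintype P] [DecidableEq P]
  [Fintype A] [DecidableEq A]

/-- The code words are orthonormal, have orthogonal supports on the auxiliary system, and are
eigenvectors of the compressed signal with eigenvalues `l₀` and `l₁`. -/
structure IsOrthogonalCode (G : Matrix P P ℂ) (C₀ C₁ : P × A → ℂ) (l₀ l₁ : ℝ) : Prop where
  h00 : star C₀ ⬝ᵥ C₀ = 1
  h11 : star C₁ ⬝ᵥ C₁ = 1
  aux : ∀ p q, ∑ a, star (C₀ (p, a)) * C₁ (q, a) = 0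
  sig₀ : star C₀ ⬝ᵥ ((G ⊗ₖ (1 : Matrix A A ℂ)) *ᵥ C₀) = l₀
  sig₁ : star C₁ ⬝ᵥ ((G ⊗ₖ (1 : Matrix A A ℂ)) *ᵥ C₁) = l₁

/-- The Hamiltonian after pinching by the syndrome measurement. -/
noncomputable def zenoHamiltonian (HEP : Matrix (E × P) (E × P) ℂ)
    (G : Matrix P P ℂ) (C₀ C₁ : P × A → ℂ) (ω : ℝ) : Matrix (E × (P × A)) (E × (P × A)) ℂ :=
  syndrome C₀ C₁ (hamiltonian HEP G ω)

namespace IsOrthogonalCode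

variable {G : Matrix P P ℂ} {C₀ C₁ : P × A → ℂ} {l₀ l₁ : ℝ}

theorem symm (h : IsOrthogonalCode G C₀ C₁ l₀ l₁) : IsOrthogonalCode G C₁ C₀ l₁ l₀ where
  h00 := h.h11
  h11 := h.h00
  aux p q := by
    have := congrArg star (h.aux q p)
    simpa [mul_comm] using this
  sig₀ := h.sig₁
  sig₁ := h.sig₀

theorem h01 (h : IsOrthogonalCode G C₀ C₁ l₀ l₁) : star C₀ ⬝ᵥ C₁ = 0 := by
  simp only [dotProduct, Fintype.sum_prod_type, Pi.star_apply]
  exact Finset.sum_eq_zero fun p _ => h.aux p p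

theorem one_kronecker_codeProj :
    (1 : Matrix E E ℂ) ⊗ₖ codeProj C₀ C₁ =
      embed E C₀ * (embed E C₀)ᴴ + embed E C₁ * (embed E C₁)ᴴ := by
  rw [codeProj, kronecker_add, one_kronecker_ketBra, one_kronecker_ketBra]

theorem codeProj_mul_self (h : IsOrthogonalCode G C₀ C₁ l₀ l₁) :
    codeProj C₀ C₁ * codeProj C₀ C₁ = codeProj C₀ C₁ := by
  simp only [codeProj, ketBra, Matrix.add_mul, Matrix.mul_add, vecMulVec_star_mul, h.h00, h.h11,
    h.h01, h.symm.h01, one_smul, zero_smul, add_zero, zero_add]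

theorem compress_self (h : IsOrthogonalCode G C₀ C₁ l₀ l₁) (HEP : Matrix (E × P) (E × P) ℂ)
    (ω : ℝ) : (embed E C₀)ᴴ * hamiltonian (A := A) HEP G ω * embed E C₀ =
      envBlock HEP C₀ + ((ω * l₀ : ℝ) : ℂ) • 1 := by
  rw [hamiltonian, Matrix.mul_add, Matrix.add_mul, ← envBlock_eq, extend_one_kronecker,
    Matrix.mul_smul, Matrix.smul_mul, embed_one_kronecker_embed, h.sig₀, smul_smul]
  push_cast
  rfl

theorem compress_cross (h : IsOrthogonalCode G C₀ C₁ l₀ l₁) (HEP : Matrix (E × P) (E × P) ℂ)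
    (ω : ℝ) : (embed E C₁)ᴴ * hamiltonian (A := A) HEP G ω * embed E C₀ = 0 := by
  rw [hamiltonian, Matrix.mul_add, Matrix.add_mul, Matrix.mul_smul, Matrix.smul_mul,
    embed_extend_embed_eq_zero h.symm.aux, embed_extend_embed_eq_zero h.symm.aux]
  simp

theorem zenoHamiltonian_mul_embed (h : IsOrthogonalCode G C₀ C₁ l₀ l₁)
    (HEP : Matrix (E × P) (E × P) ℂ) (ω : ℝ) :
    zenoHamiltonian HEP G C₀ C₁ ω * embed E C₀ =
      embed E C₀ * (envBlock HEP C₀ + ((ω * l₀ : ℝ) : ℂ) • 1) := by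
  refine pinch_mul_isometry one_kronecker_codeProj ?_ ?_ (h.compress_self HEP ω)
    (h.compress_cross HEP ω)
  · rw [embed_conjTranspose_mul_embed, h.h00, one_smul]
  · rw [embed_conjTranspose_mul_embed, h.symm.h01, zero_smul]

theorem propagator_zenoHamiltonian_mul_embed (h : IsOrthogonalCode G C₀ C₁ l₀ l₁)
    (HEP : Matrix (E × P) (E × P) ℂ) (ω t : ℝ) :
    propagator (zenoHamiltonian HEP G C₀ C₁ ω) t * embed E C₀ =
      Complex.exp (-(Complex.I * (t * (ω * l₀) : ℝ))) •
        (embed E C₀ * propagator (envBlock HEP C₀) t) := by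
  rw [propagator_mul_of_intertwines (h.zenoHamiltonian_mul_embed HEP ω), propagator_add_smul_one,
    Matrix.mul_smul]

end IsOrthogonalCode

theorem isHermitian_hamiltonian {HEP : Matrix (E × P) (E × P) ℂ} (hH : HEP.IsHermitian)
    {G : Matrix P P ℂ} (hG : G.IsHermitian) (ω : ℝ) :
    (hamiltonian (A := A) HEP G ω).IsHermitian := by
  refine (isHermitian_extend hH).add ?_
  rw [IsHermitian, conjTranspose_smul, isHermitian_extend (isHermitian_one_kronecker hG)]
  simp

theorem isHermitian_codeProj (C₀ C₁ : P → ℂ) : (ketBra C₀ + ketBra C₁).IsHermitian := by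
  simp [IsHermitian, ketBra, conjTranspose_vecMulVec]

theorem isHermitian_zenoHamiltonian {HEP : Matrix (E × P) (E × P) ℂ} (hH : HEP.IsHermitian)
    {G : Matrix P P ℂ} (hG : G.IsHermitian) (C₀ C₁ : P × A → ℂ) (ω : ℝ) :
    (zenoHamiltonian HEP G C₀ C₁ ω).IsHermitian := by
  have hp : ((1 : Matrix E E ℂ) ⊗ₖ codeProj C₀ C₁).IsHermitian :=
    isHermitian_one_kronecker (isHermitian_codeProj C₀ C₁)
  have hh := isHermitian_hamiltonian (A := A) hH hG ω
  have hq := (isHermitian_one (α := ℂ) (n := E × (P × A))).sub hp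
  rw [IsHermitian, zenoHamiltonian, syndrome, conjTranspose_add]
  simp only [conjTranspose_mul]
  rw [hp, hh, hq]
  simp only [Matrix.mul_assoc]

theorem isHermitian_envBlock {HEP : Matrix (E × P) (E × P) ℂ} (hH : HEP.IsHermitian)
    (C : P × A → ℂ) : (envBlock HEP C).IsHermitian := by
  rw [envBlock_eq]
  exact isHermitian_conjTranspose_mul_mul _ (isHermitian_extend hH)

/-- The initial state `ρE ⊗ |ψ⟩⟨ψ|` with `ψ = (C₀ + C₁)/√2`. -/
noncomputable def initialState (C₀ C₁ : P → ℂ) (ρE : Matrix E E ℂ) : Matrix (E × P) (E × P) ℂ :=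
  ρE ⊗ₖ ketBra (((1 / Real.sqrt 2 : ℝ) : ℂ) • (C₀ + C₁))

theorem initialState_eq (C₀ C₁ : P → ℂ) (ρE : Matrix E E ℂ) :
    initialState C₀ C₁ ρE =
      (1 / 2 : ℂ) • ((embed E C₀ + embed E C₁) * ρE * (embed E C₀ + embed E C₁)ᴴ) := by
  have hs : ((1 / Real.sqrt 2 : ℝ) : ℂ) * ((1 / Real.sqrt 2 : ℝ) : ℂ) = 1 / 2 := by
    rw [← Complex.ofReal_mul, div_mul_div_comm, Real.mul_self_sqrt (by norm_num)]
    norm_num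
  have he : embed E C₀ + embed E C₁ = embed E (C₀ + C₁) := by
    ext ⟨e, x⟩ f
    simp only [embed, Matrix.add_apply, of_apply, Pi.add_apply]
    split_ifs <;> simp
  rw [he, embed_mul_mul_embed_conjTranspose, ← kronecker_smul, initialState, ketBra]
  congr 1
  ext x y
  simp only [vecMulVec_apply, Matrix.smul_apply, Pi.smul_apply, Pi.star_apply, star_smul,
    smul_eq_mul, ← hs]
  have : star (((1 / Real.sqrt 2 : ℝ) : ℂ)) = ((1 / Real.sqrt 2 : ℝ) : ℂ) := Complex.conj_ofReal _
  rw [this]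
  ring

/-- The joint state in the limit of infinitely frequent syndrome measurements. -/
noncomputable def limitState (HEP : Matrix (E × P) (E × P) ℂ) (G : Matrix P P ℂ)
    (C₀ C₁ : P × A → ℂ) (ρE : Matrix E E ℂ) (ω t : ℝ) : Matrix (E × (P × A)) (E × (P × A)) ℂ :=
  evolve (zenoHamiltonian HEP G C₀ C₁ ω) t (initialState C₀ C₁ ρE)

theorem limitState_eq {HEP : Matrix (E × P) (E × P) ℂ}
    (hH : HEP.IsHermitian) {G : Matrix P P ℂ} (hG : G.IsHermitian) (C₀ C₁ : P × A → ℂ) (ρE : Matrix E E ℂ) (ω t : ℝ) :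
    limitState HEP G C₀ C₁ ρE ω t = (1 / 2 : ℂ) •
      ((propagator (zenoHamiltonian HEP G C₀ C₁ ω) t * (embed E C₀ + embed E C₁)) * ρE *
        (propagator (zenoHamiltonian HEP G C₀ C₁ ω) t * (embed E C₀ + embed E C₁))ᴴ) := by
  rw [limitState, initialState_eq, evolve_eq_propagator (isHermitian_zenoHamiltonian hH hG C₀ C₁ ω)]
  simp only [conjTranspose_mul, Matrix.mul_smul, Matrix.smul_mul, Matrix.mul_assoc]

/-- The coherence `½ Tr (e^{-it B₀} ρE e^{it B₁})`. -/
noncomputable def coherence (B₀ B₁ ρE : Matrix E E ℂ) (t : ℝ) : ℂ :=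
  (1 / 2 : ℂ) * (propagator B₀ t * ρE * (propagator B₁ t)ᴴ).trace

namespace IsOrthogonalCode

variable {G : Matrix P P ℂ} {C₀ C₁ : P × A → ℂ} {l₀ l₁ : ℝ}

attribute [local instance] Matrix.linftyOpNormedRing Matrix.linftyOpNormedAlgebra in
theorem tendsto_protocolState (h : IsOrthogonalCode G C₀ C₁ l₀ l₁)
    (HEP : Matrix (E × P) (E × P) ℂ) (ρE : Matrix E E ℂ) (ω t : ℝ) :
    Tendsto (fun N => protocolState HEP G C₀ C₁ ρE ω t N) atTop
      (𝓝 (limitState HEP G C₀ C₁ ρE ω t)) := by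
  have hp : ((1 : Matrix E E ℂ) ⊗ₖ codeProj C₀ C₁) * ((1 : Matrix E E ℂ) ⊗ₖ codeProj C₀ C₁) =
      (1 : Matrix E E ℂ) ⊗ₖ codeProj C₀ C₁ := by
    rw [← mul_kronecker_mul, h.codeProj_mul_self, Matrix.one_mul]
  -- The initial vector lies in the code space, so the first measurement would leave the state
  -- alone.
  have hx : Commute ((1 : Matrix E E ℂ) ⊗ₖ codeProj C₀ C₁) (initialState C₀ C₁ ρE) := by
    have h1 : codeProj C₀ C₁ * ketBra (((1 / Real.sqrt 2 : ℝ) : ℂ) • (C₀ + C₁)) =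
        ketBra (((1 / Real.sqrt 2 : ℝ) : ℂ) • (C₀ + C₁)) * codeProj C₀ C₁ := by
      simp only [codeProj, ketBra, Matrix.add_mul, Matrix.mul_add, vecMulVec_star_mul, h.h00, h.h11,
        h.h01, h.symm.h01, star_smul, star_add, vecMulVec_smul, smul_vecMulVec, vecMulVec_add, add_vecMulVec,
        smul_add, smul_mul_assoc, mul_smul_comm, smul_smul, one_smul, zero_smul, add_zero,
        zero_add, smul_zero]
    change _ * _ = _ * _
    rw [initialState, ← mul_kronecker_mul, ← mul_kronecker_mul, h1, Matrix.one_mul, Matrix.mul_one]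
  have key := tendsto_zeno hp (hamiltonian HEP G ω) hx t
  have e : ∀ (K : Matrix (E × (P × A)) (E × (P × A)) ℂ) (τ : ℝ) ρ,
      conjExp K τ ρ = evolve K τ ρ := fun K τ ρ => conjExp_apply K τ ρ
  have e2 : ∀ ρ, pinch ((1 : Matrix E E ℂ) ⊗ₖ codeProj C₀ C₁) ρ = syndrome C₀ C₁ ρ :=
    fun ρ => pinch_apply _ ρ
  simp only [e, e2] at key
  exact key

theorem isDensity_limitState (h : IsOrthogonalCode G C₀ C₁ l₀ l₁)
    {HEP : Matrix (E × P) (E × P) ℂ} (hH : HEP.IsHermitian) (hG : G.IsHermitian)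
    {ρE : Matrix E E ℂ} (hρ : IsDensity ρE) (ω t : ℝ) :
    IsDensity (limitState HEP G C₀ C₁ ρE ω t) := by
  rw [limitState_eq hH hG]
  set V := propagator (zenoHamiltonian HEP G C₀ C₁ ω) t with hV
  have hVV : Vᴴ * V = 1 :=
    propagator_conjTranspose_mul_self (isHermitian_zenoHamiltonian hH hG C₀ C₁ ω) t
  constructor
  · refine (hρ.1.mul_mul_conjTranspose_same _).smul ?_
    norm_num [Complex.le_def]
  · have hWW : (embed E C₀ + embed E C₁)ᴴ * (embed E C₀ + embed E C₁) =
        (2 : ℂ) • (1 : Matrix E E ℂ) := by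
      rw [conjTranspose_add, Matrix.add_mul, Matrix.mul_add, Matrix.mul_add]
      simp only [embed_conjTranspose_mul_embed, h.h00, h.h11, h.h01, h.symm.h01]
      simp [two_smul]
    rw [trace_smul, trace_mul_comm, ← Matrix.mul_assoc, conjTranspose_mul, Matrix.mul_assoc _ Vᴴ,
      ← Matrix.mul_assoc Vᴴ V, hVV, Matrix.one_mul, hWW, Matrix.smul_mul, Matrix.one_mul,
      trace_smul, hρ.2]
    norm_num

/-- The propagator keeps each branch on its own code word and evolves its environment by `Bᵢ`, up to
the phase from `ω lᵢ`. Tracing out the environment leaves unit traces on the diagonal, by unitarity,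
and the overlap of the two environment evolutions off the diagonal. -/
theorem traceFst_limitState (h : IsOrthogonalCode G C₀ C₁ l₀ l₁)
    {HEP : Matrix (E × P) (E × P) ℂ} (hH : HEP.IsHermitian) (hG : G.IsHermitian)
    {ρE : Matrix E E ℂ} (hρ : IsDensity ρE) (ω t : ℝ) :
    traceFst (limitState HEP G C₀ C₁ ρE ω t) = signalState C₀ C₁
      (Complex.exp (-(Complex.I * (t * (ω * (l₀ - l₁)) : ℝ))) *
        coherence (envBlock HEP C₀) (envBlock HEP C₁) ρE t) := by
  have hadd : ∀ X Y : Matrix (E × (P × A)) (E × (P × A)) ℂ,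
      traceFst (X + Y) = traceFst X + traceFst Y := by
    intro X Y; ext x y; simp [traceFst, Finset.sum_add_distrib]
  have hsmul : ∀ (c : ℂ) (X : Matrix (E × (P × A)) (E × (P × A)) ℂ),
      traceFst (c • X) = c • traceFst X := by
    intro c X; ext x y; simp [traceFst, Finset.mul_sum]
  have hW0 := h.propagator_zenoHamiltonian_mul_embed HEP ω t
  have hW1 := h.symm.propagator_zenoHamiltonian_mul_embed HEP ω t
  -- The pinching is symmetric in the code words, so the swapped statement concerns the same
  -- propagator.
  have hcomm : zenoHamiltonian HEP G C₁ C₀ ω = zenoHamiltonian HEP G C₀ C₁ ω := by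
    simp only [zenoHamiltonian, syndrome, codeProj, add_comm]
  rw [hcomm] at hW1
  rw [limitState_eq hH hG, Matrix.mul_add, hW0, hW1]
  set V₀ := propagator (envBlock HEP C₀) t with hV0
  set V₁ := propagator (envBlock HEP C₁) t with hV1
  set z₀ := Complex.exp (-(Complex.I * (t * (ω * l₀) : ℝ))) with hz0
  set z₁ := Complex.exp (-(Complex.I * (t * (ω * l₁) : ℝ))) with hz1
  have hgen : ∀ (z w : ℂ) (C D : P × A → ℂ) (V W : Matrix E E ℂ),
      traceFst ((z • (embed E C * V)) * ρE * (w • (embed E D * W))ᴴ) =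
        (z * star w * (V * ρE * Wᴴ).trace) • vecMulVec C (star D) := by
    intro z w C D V W
    rw [conjTranspose_smul, Matrix.smul_mul, Matrix.smul_mul, Matrix.mul_smul, hsmul, hsmul,
      conjTranspose_mul, smul_smul, ← smul_smul (z * star w), ← traceFst_embed_mul_mul]
    simp only [Matrix.mul_assoc]
  have hunit : ∀ (C : P × A → ℂ), (propagator (envBlock HEP C) t * ρE *
      (propagator (envBlock HEP C) t)ᴴ).trace = 1 := by
    intro C
    rw [trace_mul_comm, ← Matrix.mul_assoc,
      propagator_conjTranspose_mul_self (isHermitian_envBlock hH C), Matrix.one_mul, hρ.2]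
  have hz : ∀ x y : ℝ, Complex.exp (-(Complex.I * (x : ℂ))) *
      star (Complex.exp (-(Complex.I * (y : ℂ)))) = Complex.exp (-(Complex.I * ((x - y : ℝ) : ℂ))) := by
    intro x y
    rw [Complex.star_def, ← Complex.exp_conj, ← Complex.exp_add]
    congr 1
    simp
    ring
  have hswap : (V₁ * ρE * V₀ᴴ).trace = star (V₀ * ρE * V₁ᴴ).trace := by
    rw [← trace_conjTranspose]
    simp only [conjTranspose_mul, conjTranspose_conjTranspose, Matrix.mul_assoc]
    rw [hρ.1.isHermitian]
  rw [conjTranspose_add, Matrix.add_mul, Matrix.mul_add, Matrix.add_mul, Matrix.add_mul]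
  simp only [hsmul, hadd, hgen]
  rw [hunit, hunit, hswap, hz0, hz1, hz, hz, hz, hz, signalState, coherence, ← hV0, ← hV1]
  ext x y
  have hc : star (Complex.exp (-(Complex.I * ((t * (ω * l₀) - t * (ω * l₁) : ℝ) : ℂ)))) =
      Complex.exp (-(Complex.I * ((t * (ω * l₁) - t * (ω * l₀) : ℝ) : ℂ))) := by
    rw [Complex.star_def, ← Complex.exp_conj]
    congr 1
    simp
    ring
  have hd : t * (ω * (l₀ - l₁)) = t * (ω * l₀) - t * (ω * l₁) := by ring
  rw [hd, star_mul', star_mul', hc]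
  simp [ketBra]
  ring

end IsOrthogonalCode

end LimitState

/-! ### Almost periods of exponential sums and the spectral form of the coherence. -/

section AlmostPeriods

theorem norm_exp_neg_I_mul (x : ℝ) : ‖Complex.exp (-(Complex.I * (x : ℂ)))‖ = 1 := by
  have : -(Complex.I * (x : ℂ)) = ((-x : ℝ) : ℂ) * Complex.I := by push_cast; ring
  rw [this, Complex.norm_exp_ofReal_mul_I]

/-- Finitely many characters of `ℝ` have a relatively dense set of common almost periods. -/
theorem exists_common_almostPeriod {ι : Type*} [Fintype ι] (θ : ι → ℝ) {ε : ℝ} (hε : 0 < ε) :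
    ∃ L > 0, ∀ a : ℝ, ∃ τ ∈ Set.Icc a (a + L), ∀ j,
      ‖Complex.exp (-(Complex.I * (τ * θ j : ℝ))) - 1‖ ≤ ε := by
  set φ : ℝ → ι → ℂ := fun t j => Complex.exp (-(Complex.I * (t * θ j : ℝ))) with hφ
  have hnorm : ∀ t j, ‖φ t j‖ = 1 := fun t j => norm_exp_neg_I_mul (t * θ j)
  -- The characters trace an orbit in a torus, so finitely many orbit points `φ s` form an `ε`-net,
  -- and the times `s` representing them are bounded by some `M`.
  have hb : TotallyBounded (Set.range φ) := by
    refine (isCompact_closedBall (0 : ι → ℂ) 1).totallyBounded.subset ?_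
    rintro _ ⟨t, rfl⟩
    rw [mem_closedBall_zero_iff, pi_norm_le_iff_of_nonneg zero_le_one]
    exact fun j => (hnorm t j).le
  obtain ⟨T, hTs, hTfin, hT⟩ := Metric.finite_approx_of_totallyBounded hb ε hε
  obtain ⟨M, hM⟩ := (hTfin.image fun y => |Function.invFun φ y|).bddAbove
  -- Match `φ (a + max M 0)` with a net point `φ s`, `|s| ≤ max M 0`. The time difference lies in
  -- `[a, a + 2 max M 0]` and is an almost period because `φ` is multiplicative. The `+ 1` only
  -- keeps the length positive.
  refine ⟨2 * max M 0 + 1, by positivity, fun a => ?_⟩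
  obtain ⟨y, hyT, hy⟩ := Set.mem_iUnion₂.1 (hT ⟨a + max M 0, rfl⟩)
  set s := Function.invFun φ y with hs
  have hφs : φ s = y := Function.invFun_eq (hTs hyT)
  have hsM : |s| ≤ max M 0 := (hM ⟨y, hyT, rfl⟩).trans (le_max_left _ _)
  have hs2 := abs_le.1 hsM
  refine ⟨a + max M 0 - s, ⟨by linarith, by linarith⟩, fun j => ?_⟩
  have h1 : ‖φ (a + max M 0) j - φ s j‖ ≤ ε := by
    rw [Metric.mem_ball, dist_eq_norm, ← hφs] at hy
    exact (norm_le_pi_norm (φ (a + max M 0) - φ s) j).trans hy.le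
  have h2 : φ (a + max M 0) j - φ s j = φ s j * (φ (a + max M 0 - s) j - 1) := by
    rw [mul_sub, mul_one]
    congr 1
    simp only [hφ]
    rw [← Complex.exp_add]
    congr 1
    push_cast
    ring
  rw [h2, norm_mul, hnorm, one_mul] at h1
  exact h1

set_option linter.unusedSectionVars false

variable {E : Type*} [Fintype E] [DecidableEq E]

theorem exists_almostPeriod_expSum (ρE : Matrix E E ℂ)
    (u v : OrthonormalBasis E ℂ (EuclideanSpace ℂ E)) (a b : E → ℝ) {ε : ℝ} (hε : 0 < ε) :
    ∃ L > 0, ∀ x : ℝ, ∃ τ ∈ Set.Icc x (x + L), ∀ t,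
      ‖expSum ρE u v a b (t + τ) - expSum ρE u v a b t‖ ≤ ε := by
  set c : E → E → ℂ := fun k l => (1 / 2 : ℂ) * (star (u k).ofLp ⬝ᵥ (ρE *ᵥ (v l).ofLp)) *
    (star (v l).ofLp ⬝ᵥ (u k).ofLp) with hc
  set K : ℝ := ∑ k, ∑ l, ‖c k l‖ with hK
  have hK0 : 0 ≤ K := Finset.sum_nonneg fun k _ => Finset.sum_nonneg fun l _ => norm_nonneg _
  -- Each term moves by at most its coefficient's norm times the tolerance; `K + 1` in place of `K`
  -- covers the case of vanishing coefficients.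
  obtain ⟨L, hL, h⟩ := exists_common_almostPeriod (fun z : E × E => a z.1 - b z.2)
    (ε := ε / (K + 1)) (by positivity)
  refine ⟨L, hL, fun x => ?_⟩
  obtain ⟨τ, hτ, hτ'⟩ := h x
  refine ⟨τ, hτ, fun t => ?_⟩
  have e : expSum ρE u v a b (t + τ) - expSum ρE u v a b t = ∑ k, ∑ l,
      c k l * Complex.exp (-(Complex.I * (t * (a k - b l) : ℝ))) *
        (Complex.exp (-(Complex.I * (τ * (a k - b l) : ℝ))) - 1) := by
    simp only [expSum, ← Finset.sum_sub_distrib]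
    refine Finset.sum_congr rfl fun k _ => Finset.sum_congr rfl fun l _ => ?_
    have hmul : Complex.exp (-(Complex.I * ((t + τ) * (a k - b l) : ℝ))) =
        Complex.exp (-(Complex.I * (t * (a k - b l) : ℝ))) *
          Complex.exp (-(Complex.I * (τ * (a k - b l) : ℝ))) := by
      rw [← Complex.exp_add]
      congr 1
      push_cast
      ring
    rw [hmul, hc]
    ring
  rw [e]
  calc _ ≤ ∑ k, ∑ l, ‖c k l‖ * (ε / (K + 1)) := by
        refine (norm_sum_le _ _).trans (Finset.sum_le_sum fun k _ =>
          (norm_sum_le _ _).trans (Finset.sum_le_sum fun l _ => ?_))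
        rw [norm_mul, norm_mul, norm_exp_neg_I_mul, mul_one]
        exact mul_le_mul_of_nonneg_left (hτ' (k, l)) (norm_nonneg _)
    _ = K * (ε / (K + 1)) := by simp only [hK, Finset.sum_mul]
    _ ≤ ε := by
        rw [mul_div_assoc', div_le_iff₀ (by positivity)]
        nlinarith

theorem continuous_expSum (ρE : Matrix E E ℂ)
    (u v : OrthonormalBasis E ℂ (EuclideanSpace ℂ E)) (a b : E → ℝ) :
    Continuous (expSum ρE u v a b) := by
  unfold expSum
  fun_prop

theorem isAlmostPeriodic_envelope {ρE : Matrix E E ℂ}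
    {u v : OrthonormalBasis E ℂ (EuclideanSpace ℂ E)} {a b : E → ℝ}
    (hle : ∀ t, ‖expSum ρE u v a b t‖ ≤ 1 / 2) (c : ℝ) :
    IsAlmostPeriodic fun t => 4 * c ^ 2 * ‖expSum ρE u v a b t‖ ^ 2 := by
  refine ⟨by have := continuous_expSum ρE u v a b; fun_prop, fun ε hε => ?_⟩
  obtain ⟨L, hL, h⟩ := exists_almostPeriod_expSum ρE u v a b (ε := ε / (4 * c ^ 2 + 1))
    (by positivity)
  refine ⟨L, hL, fun x => ?_⟩
  obtain ⟨τ, hτ, hτ'⟩ := h x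
  refine ⟨τ, hτ, fun t => ?_⟩
  have h1 := (abs_norm_sub_norm_le _ _).trans (hτ' t)
  have h2 := hle t
  have h3 := hle (t + τ)
  set y := ‖expSum ρE u v a b (t + τ)‖
  set z := ‖expSum ρE u v a b t‖
  have hy : 0 ≤ y := norm_nonneg _
  have hz : 0 ≤ z := norm_nonneg _
  -- Both norms are at most `½`, so `y + z ≤ 1` and squaring does not enlarge the difference.
  have e : 4 * c ^ 2 * y ^ 2 - 4 * c ^ 2 * z ^ 2 = 4 * c ^ 2 * ((y - z) * (y + z)) := by ring
  rw [e, abs_mul (4 * c ^ 2), abs_mul (y - z), abs_of_nonneg (by positivity : 0 ≤ 4 * c ^ 2),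
    abs_of_nonneg (by positivity : 0 ≤ y + z)]
  calc 4 * c ^ 2 * (|y - z| * (y + z)) ≤ 4 * c ^ 2 * (ε / (4 * c ^ 2 + 1) * 1) := by
        gcongr
        linarith
    _ ≤ ε := by
        rw [mul_one, mul_div_assoc', div_le_iff₀ (by positivity)]
        nlinarith [sq_nonneg c]

/-- An almost periodic function returns to its value at `0` along a sequence of times. -/
theorem IsAlmostPeriodic.exists_tendsto {f : ℝ → ℝ} (hf : IsAlmostPeriodic f) :
    ∃ τ : ℕ → ℝ, Tendsto τ atTop atTop ∧ Tendsto (fun m => f (τ m)) atTop (𝓝 (f 0)) := by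
  have h : ∀ m : ℕ, ∃ τ : ℝ, (m : ℝ) ≤ τ ∧ |f τ - f 0| ≤ 1 / ((m : ℝ) + 1) := by
    intro m
    obtain ⟨L, -, hL⟩ := hf.2 (1 / ((m : ℝ) + 1)) (by positivity)
    obtain ⟨τ, hτ, h⟩ := hL m
    exact ⟨τ, hτ.1, by simpa using h 0⟩
  choose τ h1 h2 using h
  refine ⟨τ, tendsto_atTop_mono h1 tendsto_natCast_atTop_atTop, ?_⟩
  rw [tendsto_iff_dist_tendsto_zero]
  exact squeeze_zero (fun _ => dist_nonneg) h2 tendsto_one_div_add_atTop_nhds_zero_nat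

theorem propagator_eq_spectral {B : Matrix E E ℂ} (hB : B.IsHermitian) (t : ℝ) :
    propagator B t = (hB.eigenvectorUnitary : Matrix E E ℂ) *
      (diagonal fun i => Complex.exp (-(Complex.I * (t * hB.eigenvalues i : ℝ)))) *
      (hB.eigenvectorUnitary : Matrix E E ℂ)ᴴ := by
  have hUU : (hB.eigenvectorUnitary : Matrix E E ℂ) * (hB.eigenvectorUnitary : Matrix E E ℂ)ᴴ = 1 :=
    Unitary.coe_mul_star_self hB.eigenvectorUnitary
  have hspec : B * (hB.eigenvectorUnitary : Matrix E E ℂ) =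
      (hB.eigenvectorUnitary : Matrix E E ℂ) * diagonal fun i => (hB.eigenvalues i : ℂ) :=
    mul_eigenvectorUnitary hB
  rw [← propagator_diagonal, ← propagator_mul_of_intertwines hspec, Matrix.mul_assoc, hUU,
    Matrix.mul_one]

/-- Substituting the spectral forms of the two propagators into the trace turns it into a double sum
over eigenvectors, each pair carrying the phase of its eigenvalue difference. -/
theorem expSum_eq_coherence {B₀ B₁ : Matrix E E ℂ} (h₀ : B₀.IsHermitian) (h₁ : B₁.IsHermitian)
    (ρE : Matrix E E ℂ) (t : ℝ) :
    expSum ρE h₀.eigenvectorBasis h₁.eigenvectorBasis h₀.eigenvalues h₁.eigenvalues t =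
      coherence B₀ B₁ ρE t := by
  rw [coherence, propagator_eq_spectral h₀, propagator_eq_spectral h₁]
  set U : Matrix E E ℂ := (h₀.eigenvectorUnitary : Matrix E E ℂ) with hU
  set V : Matrix E E ℂ := (h₁.eigenvectorUnitary : Matrix E E ℂ) with hV
  set d₀ : E → ℂ := fun i => Complex.exp (-(Complex.I * (t * h₀.eigenvalues i : ℝ))) with hd0
  set d₁ : E → ℂ := fun i => Complex.exp (-(Complex.I * (t * h₁.eigenvalues i : ℝ))) with hd1
  have e1 : (U * diagonal d₀ * Uᴴ * ρE * (V * diagonal d₁ * Vᴴ)ᴴ).trace =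
      ((diagonal d₀ * (Uᴴ * (ρE * V))) * (diagonal (star d₁) * (Vᴴ * U))).trace := by
    simp only [conjTranspose_mul, conjTranspose_conjTranspose, diagonal_conjTranspose,
      Matrix.mul_assoc]
    rw [trace_mul_comm U]
    simp only [Matrix.mul_assoc]
  have e2 : ∀ k l, star (h₀.eigenvectorBasis k).ofLp ⬝ᵥ (ρE *ᵥ (h₁.eigenvectorBasis l).ofLp) =
      (Uᴴ * (ρE * V)) k l := fun k l => rfl
  have e3 : ∀ k l, star (h₁.eigenvectorBasis l).ofLp ⬝ᵥ (h₀.eigenvectorBasis k).ofLp =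
      (Vᴴ * U) l k := fun k l => rfl
  rw [e1, expSum, trace, Finset.mul_sum]
  refine Finset.sum_congr rfl fun k _ => ?_
  rw [diag_apply, Matrix.mul_apply, Finset.mul_sum]
  refine Finset.sum_congr rfl fun l _ => ?_
  rw [diagonal_mul, diagonal_mul, e2, e3]
  have e4 : Complex.exp (-(Complex.I * (t * (h₀.eigenvalues k - h₁.eigenvalues l) : ℝ))) =
      d₀ k * star d₁ l := by
    rw [Pi.star_apply, hd0, hd1, Complex.star_def, ← Complex.exp_conj, ← Complex.exp_add]
    congr 1
    simp
    ring
  rw [e4]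
  ring

end AlmostPeriods

/-! ### Construction of the code words. -/

section SchmidtVector

set_option linter.unusedSectionVars false

variable {P : Type*} [Fintype P] [DecidableEq P]

/-- The vector `∑ₐ sₐ uₐ ⊗ eₐ`, where the `uₐ` are the columns of `U`. -/
def schmidtVector (U : Matrix P P ℂ) (s : P → ℝ) : P × P → ℂ := fun x => U x.1 x.2 * s x.2

theorem star_schmidtVector_dotProduct {U : Matrix P P ℂ} (hU : Uᴴ * U = 1) (s r : P → ℝ) :
    star (schmidtVector U s) ⬝ᵥ schmidtVector U r = ((∑ a, s a * r a : ℝ) : ℂ) := by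
  simp only [dotProduct, schmidtVector, Fintype.sum_prod_type, Pi.star_apply, star_mul']
  rw [Finset.sum_comm]
  push_cast
  refine Finset.sum_congr rfl fun a _ => ?_
  have h := congrFun (congrFun hU a) a
  rw [Matrix.mul_apply, one_apply_eq] at h
  simp only [conjTranspose_apply] at h
  rw [← one_mul ((s a : ℂ) * r a), ← h, Finset.sum_mul]
  refine Finset.sum_congr rfl fun p _ => ?_
  have : star (s a : ℂ) = s a := Complex.conj_ofReal _
  rw [this]
  ring

/-- The columns of `U` are eigenvectors of `G`, so the signal merely rescales the Schmidt
coefficients. The signal values of the code words thus become weighted means of eigenvalues. -/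
theorem kronecker_one_mulVec_schmidtVector {G U : Matrix P P ℂ} {γ : P → ℝ}
    (hG : G * U = U * diagonal fun i => (γ i : ℂ)) (s : P → ℝ) :
    (G ⊗ₖ (1 : Matrix P P ℂ)) *ᵥ schmidtVector U s = schmidtVector U fun a => γ a * s a := by
  funext ⟨p, a⟩
  have h := congrFun (congrFun hG p) a
  rw [mul_diagonal, Matrix.mul_apply] at h
  simp only [mulVec, dotProduct, schmidtVector, Fintype.sum_prod_type, kroneckerMap_apply,
    one_apply, mul_ite, ite_mul, mul_one, mul_zero, zero_mul, Finset.sum_ite_eq, Finset.mem_univ,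
    if_true]
  push_cast
  rw [← mul_assoc, ← h, Finset.sum_mul]
  exact Finset.sum_congr rfl fun q _ => by ring

theorem traceSnd_ketBra_schmidtVector (U : Matrix P P ℂ) (s : P → ℝ) :
    traceSnd (ketBra (schmidtVector U s)) =
      U * (diagonal fun a => ((s a * s a : ℝ) : ℂ)) * Uᴴ := by
  ext p q
  rw [Matrix.mul_apply]
  simp only [traceSnd, ketBra, vecMulVec_apply, schmidtVector, of_apply, mul_diagonal,
    conjTranspose_apply, Pi.star_apply, star_mul']
  refine Finset.sum_congr rfl fun a _ => ?_
  have : star (s a : ℂ) = s a := Complex.conj_ofReal _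
  rw [this]
  push_cast
  ring

theorem traceFst_ketBra_schmidtVector {U : Matrix P P ℂ} (hU : Uᴴ * U = 1) (s : P → ℝ) :
    traceFst (ketBra (schmidtVector U s)) = diagonal fun a => ((s a * s a : ℝ) : ℂ) := by
  ext a b
  have h := congrFun (congrFun hU b) a
  rw [Matrix.mul_apply] at h
  simp only [conjTranspose_apply] at h
  have hs : star (s b : ℂ) = s b := Complex.conj_ofReal _
  have e : traceFst (ketBra (schmidtVector U s)) a b =
      (∑ p, star (U p b) * U p a) * ((s a : ℂ) * s b) := by
    simp only [traceFst, ketBra, vecMulVec_apply, schmidtVector, of_apply, Pi.star_apply, star_mul',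
      hs, Finset.sum_mul]
    exact Finset.sum_congr rfl fun p _ => by ring
  rw [e, h]
  by_cases hab : a = b
  · subst hab; simp
  · rw [one_apply_ne (Ne.symm hab), diagonal_apply_ne _ hab, zero_mul]

theorem schmidtVector_aux (U : Matrix P P ℂ) {s r : P → ℝ} (h : ∀ a, s a * r a = 0) (p q : P) :
    ∑ a, star (schmidtVector U s (p, a)) * schmidtVector U r (q, a) = 0 := by
  refine Finset.sum_eq_zero fun a _ => ?_
  have hs : star (s a : ℂ) = s a := Complex.conj_ofReal _
  have h2 : (s a : ℂ) * r a = 0 := by exact_mod_cast h a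
  simp only [schmidtVector, star_mul', hs]
  linear_combination star (U p a) * U q a * h2

theorem exists_signalCode {G : Matrix P P ℂ} (hG : G.IsHermitian)
    (hne : ∀ c : ℂ, G ≠ c • (1 : Matrix P P ℂ)) :
    ∃ (C₀ C₁ : P × P → ℂ) (l₀ l₁ : ℝ), IsSignalCode G C₀ C₁ ∧ IsOrthogonalCode G C₀ C₁ l₀ l₁ ∧
      star C₁ ⬝ᵥ ((G ⊗ₖ (1 : Matrix P P ℂ)) *ᵥ C₀) = 0 ∧ l₁ < l₀ := by
  set U : Matrix P P ℂ := (hG.eigenvectorUnitary : Matrix P P ℂ) with hU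
  set γ := hG.eigenvalues with hγ
  have hUU : U * Uᴴ = 1 := Unitary.coe_mul_star_self hG.eigenvectorUnitary
  have hUU' : Uᴴ * U = 1 := Unitary.coe_star_mul_self hG.eigenvectorUnitary
  have hspec : G * U = U * diagonal fun i => (γ i : ℂ) :=
    mul_eigenvectorUnitary hG
  have hGU : G = U * (diagonal fun i => (γ i : ℂ)) * Uᴴ := by
    rw [← hspec, Matrix.mul_assoc, hUU, Matrix.mul_one]
  -- On an empty index type all matrices coincide, which would make `G` a multiple of the identity.
  have hP : Nonempty P := by
    by_contra h
    rw [not_nonempty_iff] at h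
    exact hne 0 (Subsingleton.elim _ _)
  have hcard : (Fintype.card P : ℝ) ≠ 0 := by exact_mod_cast Fintype.card_ne_zero
  set μ : ℝ := (∑ i, γ i) / Fintype.card P with hμ
  have htr : G.trace / (Fintype.card P : ℂ) = (μ : ℂ) := by
    rw [hG.trace_eq_sum_eigenvalues, hμ]
    push_cast
    rfl
  set g : P → ℝ := fun a => γ a - μ with hg
  have hgsum : ∑ a, g a = 0 := by
    simp only [hg, Finset.sum_sub_distrib, Finset.sum_const, Finset.card_univ, nsmul_eq_mul]
    rw [hμ, mul_div_cancel₀ _ hcard, sub_self]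
  have hG' : G - (μ : ℂ) • (1 : Matrix P P ℂ) = U * (diagonal fun i => (g i : ℂ)) * Uᴴ := by
    have h1 : (μ : ℂ) • (1 : Matrix P P ℂ) = U * (diagonal fun _ => (μ : ℂ)) * Uᴴ := by
      rw [← smul_one_eq_diagonal, Matrix.mul_smul, Matrix.mul_one, Matrix.smul_mul, hUU]
    rw [h1]
    nth_rewrite 1 [hGU]
    rw [← Matrix.sub_mul, ← Matrix.mul_sub, diagonal_sub]
    simp [hg]
  have hgne : ∃ a, g a ≠ 0 := by
    by_contra! h
    refine hne μ (sub_eq_zero.1 ?_)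
    rw [hG']
    simp [h]
  -- The positive mass of `g`. It equals the negative mass because `∑ g = 0`, so one constant
  -- normalises both code words.
  set c : ℝ := ∑ a, max (g a) 0 with hc
  have hsplit : ∀ a, max (g a) 0 - max (-g a) 0 = g a := fun a => by
    rcases le_total (g a) 0 with h | h
    · rw [max_eq_right h, max_eq_left (by linarith)]; ring
    · rw [max_eq_left h, max_eq_right (by linarith)]; ring
  have hc' : ∑ a, max (-g a) 0 = c := by
    have : ∑ a, (max (g a) 0 - max (-g a) 0) = 0 := by simp only [hsplit, hgsum]
    rw [Finset.sum_sub_distrib] at this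
    linarith
  have hcpos : 0 < c := by
    obtain ⟨a, ha⟩ := hgne
    rcases lt_or_gt_of_ne ha with h | h
    · rw [← hc']
      exact Finset.sum_pos' (fun _ _ => le_max_right _ _)
        ⟨a, Finset.mem_univ _, lt_max_of_lt_left (by linarith)⟩
    · exact Finset.sum_pos' (fun _ _ => le_max_right _ _)
        ⟨a, Finset.mem_univ _, lt_max_of_lt_left h⟩
  set s : P → ℝ := fun a => Real.sqrt (max (g a) 0 / c) with hs
  set r : P → ℝ := fun a => Real.sqrt (max (-g a) 0 / c) with hr
  have hss : ∀ a, s a * s a = max (g a) 0 / c := fun a =>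
    Real.mul_self_sqrt (div_nonneg (le_max_right _ _) hcpos.le)
  have hrr : ∀ a, r a * r a = max (-g a) 0 / c := fun a =>
    Real.mul_self_sqrt (div_nonneg (le_max_right _ _) hcpos.le)
  have hsr : ∀ a, s a * r a = 0 := by
    intro a
    rcases le_total (g a) 0 with h | h
    · simp [hs, max_eq_right h]
    · simp [hr, max_eq_right (neg_nonpos.2 h)]
  have hs1 : ∑ a, s a * s a = 1 := by
    simp only [hss, ← Finset.sum_div]
    exact div_self hcpos.ne'
  have hr1 : ∑ a, r a * r a = 1 := by
    simp only [hrr, ← Finset.sum_div, hc']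
    exact div_self hcpos.ne'
  have hdiag : (diagonal fun a => ((s a * s a : ℝ) : ℂ)) *
      (diagonal fun a => ((r a * r a : ℝ) : ℂ)) = 0 := by
    rw [diagonal_mul_diagonal, ← diagonal_zero]
    congr 1
    funext a
    have : s a * s a * (r a * r a) = 0 := by linear_combination (s a * r a) * hsr a
    exact_mod_cast this
  refine ⟨schmidtVector U s, schmidtVector U r, ∑ a, s a * (γ a * s a), ∑ a, r a * (γ a * r a),
    ⟨?_, ?_, ?_, ?_, c, hcpos, ?_⟩, ⟨?_, ?_, schmidtVector_aux U hsr, ?_, ?_⟩, ?_, ?_⟩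
  · rw [star_schmidtVector_dotProduct hUU', hs1, Complex.ofReal_one]
  · rw [star_schmidtVector_dotProduct hUU', hr1, Complex.ofReal_one]
  · rw [traceSnd_ketBra_schmidtVector, traceSnd_ketBra_schmidtVector, Matrix.mul_assoc,
      ← Matrix.mul_assoc Uᴴ, ← Matrix.mul_assoc Uᴴ U, hUU', Matrix.one_mul, Matrix.mul_assoc U,
      ← Matrix.mul_assoc (diagonal _) (diagonal _), hdiag]
    simp
  · rw [traceFst_ketBra_schmidtVector hUU', traceFst_ketBra_schmidtVector hUU', hdiag]
  · rw [htr, hG', traceSnd_ketBra_schmidtVector, traceSnd_ketBra_schmidtVector, ← Matrix.sub_mul,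
      ← Matrix.mul_sub, diagonal_sub, ← Matrix.smul_mul, ← Matrix.mul_smul, ← diagonal_smul]
    congr 3
    funext a
    have : g a = c * (s a * s a - r a * r a) := by
      rw [hss, hrr, ← sub_div, hsplit, mul_div_cancel₀ _ hcpos.ne']
    rw [this]
    simp
  · rw [star_schmidtVector_dotProduct hUU', hs1, Complex.ofReal_one]
  · rw [star_schmidtVector_dotProduct hUU', hr1, Complex.ofReal_one]
  · rw [kronecker_one_mulVec_schmidtVector hspec, star_schmidtVector_dotProduct hUU']
  · rw [kronecker_one_mulVec_schmidtVector hspec, star_schmidtVector_dotProduct hUU']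
  · rw [kronecker_one_mulVec_schmidtVector hspec, star_schmidtVector_dotProduct hUU']
    rw [Complex.ofReal_eq_zero]
    exact Finset.sum_eq_zero fun a _ => by linear_combination γ a * hsr a
  -- The squared weights differ by `gₐ / c`. Writing `γ = g + μ`, the contribution of the mean `μ`
  -- vanishes since `∑ g = 0`, leaving `∑ g² / c`.
  · have h1 : ∑ a, s a * (γ a * s a) - ∑ a, r a * (γ a * r a) = (∑ a, g a * g a) / c := by
      have h2 : ∀ a, s a * (γ a * s a) - r a * (γ a * r a) = g a * g a / c + μ * (g a / c) := by
        intro a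
        have : g a / c = s a * s a - r a * r a := by rw [hss, hrr, ← sub_div, hsplit]
        have h3 : γ a = g a + μ := by simp [hg]
        rw [mul_div_assoc, this, h3]
        ring
      rw [← Finset.sum_sub_distrib]
      simp only [h2, Finset.sum_add_distrib]
      rw [← Finset.mul_sum, ← Finset.sum_div, ← Finset.sum_div, hgsum]
      simp
    have h4 : 0 < (∑ a, g a * g a) / c := by
      refine div_pos ?_ hcpos
      obtain ⟨a, ha⟩ := hgne
      exact Finset.sum_pos' (fun _ _ => mul_self_nonneg _)
        ⟨a, Finset.mem_univ _, mul_self_pos.2 ha⟩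
    linarith

end SchmidtVector

/-! ### Fisher information of the protocol and its long-time behaviour. -/

section Metrology

variable {E P A : Type*} [Fintype E] [DecidableEq E] [Fintype P] [DecidableEq P]
  [Fintype A] [DecidableEq A] {G : Matrix P P ℂ} {C₀ C₁ : P × A → ℂ} {l₀ l₁ : ℝ}

namespace IsOrthogonalCode

theorem codeProj_mul_mul_codeProj_mulVec (h : IsOrthogonalCode G C₀ C₁ l₀ l₁)
    (hc : star C₁ ⬝ᵥ ((G ⊗ₖ (1 : Matrix A A ℂ)) *ᵥ C₀) = 0) :
    (codeProj C₀ C₁ * (G ⊗ₖ (1 : Matrix A A ℂ)) * codeProj C₀ C₁) *ᵥ C₀ = (l₀ : ℂ) • C₀ := by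
  rw [← mulVec_mulVec, ← mulVec_mulVec]
  simp only [codeProj, ketBra, add_mulVec, vecMulVec_mulVec, op_smul_eq_smul, h.h00, h.symm.h01,
    one_smul, zero_smul, add_zero, h.sig₀, hc]

theorem hasDerivAt_phase (t ω Δ : ℝ) (z : ℂ) :
    HasDerivAt (fun w : ℝ => Complex.exp (-(Complex.I * (t * (w * Δ) : ℝ))) * z)
      (-(Complex.I * (t * Δ : ℝ)) * (Complex.exp (-(Complex.I * (t * (ω * Δ) : ℝ))) * z)) ω := by
  have h1 : HasDerivAt (fun w : ℝ => -(Complex.I * ((t * (w * Δ) : ℝ) : ℂ)))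
      (-(Complex.I * ((t * (1 * Δ) : ℝ) : ℂ))) ω :=
    ((((hasDerivAt_id ω).mul_const Δ).const_mul t).ofReal_comp.const_mul Complex.I).neg
  refine (h1.cexp.mul_const z).congr_deriv ?_
  rw [one_mul]
  ring

variable {HEP : Matrix (E × P) (E × P) ℂ} {ρE : Matrix E E ℂ}

theorem differentiableAt_traceFst_limitState (h : IsOrthogonalCode G C₀ C₁ l₀ l₁)
    (hH : HEP.IsHermitian) (hG : G.IsHermitian) (hρ : IsDensity ρE) (ω t : ℝ) (i j : P × A) :
    DifferentiableAt ℝ (fun w => traceFst (limitState HEP G C₀ C₁ ρE w t) i j) ω := by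
  simp only [h.traceFst_limitState hH hG hρ]
  exact (hasDerivAt_signalState (hasDerivAt_phase t ω (l₀ - l₁) _) i j).differentiableAt

theorem qfi_traceFst_limitState (h : IsOrthogonalCode G C₀ C₁ l₀ l₁)
    (hH : HEP.IsHermitian) (hG : G.IsHermitian) (hρ : IsDensity ρE) (ω t : ℝ) :
    qfi (fun w => traceFst (limitState HEP G C₀ C₁ ρE w t)) ω =
      4 * t ^ 2 * (l₀ - l₁) ^ 2 * ‖coherence (envBlock HEP C₀) (envBlock HEP C₁) ρE t‖ ^ 2 := by
  simp only [h.traceFst_limitState hH hG hρ]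
  rw [qfi_signalState h.h00 h.h11 h.h01 (hasDerivAt_phase t ω (l₀ - l₁) _), norm_mul, norm_exp_neg_I_mul]
  ring

/-- The reduced limit state is positive semidefinite, which bounds its off-diagonal entry. The phase
has modulus one, so evaluating at `ω = 0` suffices. -/
theorem norm_coherence_le (h : IsOrthogonalCode G C₀ C₁ l₀ l₁)
    (hH : HEP.IsHermitian) (hG : G.IsHermitian) (hρ : IsDensity ρE) (t : ℝ) :
    ‖coherence (envBlock HEP C₀) (envBlock HEP C₁) ρE t‖ ≤ 1 / 2 := by
  have h1 := posSemidef_traceFst (h.isDensity_limitState hH hG hρ 0 t).1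
  rw [h.traceFst_limitState hH hG hρ] at h1
  have h2 := norm_le_of_posSemidef_signalState h.h00 h.h11 h.h01 h1
  rwa [norm_mul, norm_exp_neg_I_mul, one_mul] at h2

end IsOrthogonalCode

theorem coherence_zero (B₀ B₁ : Matrix E E ℂ) (hρ : IsDensity ρE) :
    coherence B₀ B₁ ρE 0 = 1 / 2 := by
  have h : ∀ B : Matrix E E ℂ, propagator B 0 = 1 := by
    intro B
    simp [propagator, NormedSpace.exp_zero]
  rw [coherence, h, h, conjTranspose_one, Matrix.one_mul, Matrix.mul_one, hρ.2, mul_one]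

/-- The eventual bound gives `≤`, and the limit along `τ` gives `≥` because a limsup along a
subsequence cannot exceed the full one. In `EReal` no separate boundedness conditions are needed. -/
theorem limsup_coe_eq_of_le_of_tendsto {F : ℝ → ℝ} {M : ℝ} (hle : ∀ᶠ t in atTop, F t ≤ M)
    {τ : ℕ → ℝ} (hτ : Tendsto τ atTop atTop) (hF : Tendsto (fun m => F (τ m)) atTop (𝓝 M)) :
    limsup (fun t => ((F t : ℝ) : EReal)) atTop = (M : EReal) := by
  refine le_antisymm (limsup_le_of_le (by isBoundedDefault)
    (hle.mono fun t ht => EReal.coe_le_coe_iff.2 ht)) ?_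
  have h1 : Tendsto (fun m => ((F (τ m) : ℝ) : EReal)) atTop (𝓝 (M : EReal)) :=
    (continuous_coe_real_ereal.tendsto M).comp hF
  rw [← h1.limsup_eq]
  change limsup ((fun t => ((F t : ℝ) : EReal)) ∘ τ) atTop ≤ _
  rw [limsup_comp]
  exact limsup_le_limsup_of_le hτ

end Metrology

end HiddenMarkov

/-! ### Assembly of the theorem. -/

open HiddenMarkov in
theorem theorem2 {E P : Type*} [Fintype E] [DecidableEq E] [Fintype P] [DecidableEq P]
    (G : Matrix P P ℂ) (hG : G.IsHermitian) (hG_nontrivial : ∀ c : ℂ, G ≠ c • (1 : Matrix P P ℂ)) :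
    ∃ (C₀ C₁ : P × P → ℂ) (lam₀ lam₁ : ℝ),
      IsSignalCode G C₀ C₁ ∧
      (codeProj C₀ C₁ * (G ⊗ₖ (1 : Matrix P P ℂ)) * codeProj C₀ C₁) *ᵥ C₀ = (lam₀ : ℂ) • C₀ ∧
      (codeProj C₀ C₁ * (G ⊗ₖ (1 : Matrix P P ℂ)) * codeProj C₀ C₁) *ᵥ C₁ = (lam₁ : ℂ) • C₁ ∧
      lam₁ < lam₀ ∧
      ∀ HEP : Matrix (E × P) (E × P) ℂ, HEP.IsHermitian →
      ∃ (u v : OrthonormalBasis E ℂ (EuclideanSpace ℂ E)) (a b : E → ℝ),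
        (∀ k, envBlock HEP C₀ *ᵥ (u k).ofLp = (a k : ℂ) • (u k).ofLp) ∧
        (∀ l, envBlock HEP C₁ *ᵥ (v l).ofLp = (b l : ℂ) • (v l).ofLp) ∧
        ∀ ρE : Matrix E E ℂ, IsDensity ρE →
          expSum ρE u v a b 0 = 1 / 2 ∧
          (∀ t, ‖expSum ρE u v a b t‖ ≤ 1 / 2) ∧
          IsAlmostPeriodic (fun t => 4 * (lam₀ - lam₁) ^ 2 * ‖expSum ρE u v a b t‖ ^ 2) ∧
          ∃ ρ : ℝ → ℝ → Matrix (E × (P × P)) (E × (P × P)) ℂ,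
            (∀ ω t : ℝ, 0 ≤ t →
              Tendsto (fun N => protocolState HEP G C₀ C₁ ρE ω t N) atTop (𝓝 (ρ ω t)) ∧
              IsDensity (ρ ω t) ∧
              (∀ i j, DifferentiableAt ℝ (fun w => traceFst (ρ w t) i j) ω) ∧
              qfi (fun w => traceFst (ρ w t)) ω =
                4 * t ^ 2 * (lam₀ - lam₁) ^ 2 * ‖expSum ρE u v a b t‖ ^ 2) ∧
            (∀ ω : ℝ,
              limsup (fun t : ℝ => ((qfi (fun w => traceFst (ρ w t)) ω / t ^ 2 : ℝ) : EReal)) atTop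
                = (((lam₀ - lam₁) ^ 2 : ℝ) : EReal)) ∧
            ∃ τ : ℕ → ℝ, Tendsto τ atTop atTop ∧
              ∀ ω : ℝ, Tendsto (fun m => qfi (fun w => traceFst (ρ w (τ m))) ω / τ m ^ 2) atTop
                (𝓝 ((lam₀ - lam₁) ^ 2)) := by
  obtain ⟨C₀, C₁, l₀, l₁, hcode, h, hcross, hlt⟩ := exists_signalCode hG hG_nontrivial
  have hcross' : star C₀ ⬝ᵥ ((G ⊗ₖ (1 : Matrix P P ℂ)) *ᵥ C₁) = 0 := by
    have hGH : (G ⊗ₖ (1 : Matrix P P ℂ))ᴴ = G ⊗ₖ (1 : Matrix P P ℂ) := by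
      rw [conjTranspose_kronecker, hG, conjTranspose_one]
    have := star_dotProduct_eq_zero_symm hcross
    rwa [star_mulVec, hGH, ← dotProduct_mulVec] at this
  refine ⟨C₀, C₁, l₀, l₁, hcode, h.codeProj_mul_mul_codeProj_mulVec hcross, ?_, hlt,
    fun HEP hH => ?_⟩
  · have := h.symm.codeProj_mul_mul_codeProj_mulVec hcross'
    rwa [codeProj, add_comm] at this
  have h₀ := isHermitian_envBlock hH C₀
  have h₁ := isHermitian_envBlock hH C₁
  refine ⟨h₀.eigenvectorBasis, h₁.eigenvectorBasis, h₀.eigenvalues, h₁.eigenvalues,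
    fun k => h₀.mulVec_eigenvectorBasis k, fun l => h₁.mulVec_eigenvectorBasis l,
    fun ρE hρ => ?_⟩
  have hα := expSum_eq_coherence h₀ h₁ ρE
  have h0 : expSum ρE h₀.eigenvectorBasis h₁.eigenvectorBasis h₀.eigenvalues h₁.eigenvalues 0 =
      1 / 2 := by rw [hα, coherence_zero _ _ hρ]
  have hle : ∀ t, ‖expSum ρE h₀.eigenvectorBasis h₁.eigenvectorBasis h₀.eigenvalues
      h₁.eigenvalues t‖ ≤ 1 / 2 := fun t => by
    rw [hα]
    exact h.norm_coherence_le hH hG hρ t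
  have hap := isAlmostPeriodic_envelope hle (l₀ - l₁)
  have hq : ∀ ω t, qfi (fun w => traceFst (limitState HEP G C₀ C₁ ρE w t)) ω =
      4 * t ^ 2 * (l₀ - l₁) ^ 2 * ‖expSum ρE h₀.eigenvectorBasis h₁.eigenvectorBasis
        h₀.eigenvalues h₁.eigenvalues t‖ ^ 2 := fun ω t => by
    rw [hα, h.qfi_traceFst_limitState hH hG hρ]
  have hdiv : ∀ ω t, 0 < t → qfi (fun w => traceFst (limitState HEP G C₀ C₁ ρE w t)) ω / t ^ 2 =
      4 * (l₀ - l₁) ^ 2 * ‖expSum ρE h₀.eigenvectorBasis h₁.eigenvectorBasis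
        h₀.eigenvalues h₁.eigenvalues t‖ ^ 2 := fun ω t ht => by
    rw [hq]
    field_simp
  -- The return times come from the envelope, which does not involve `ω`, so one sequence serves
  -- every `ω`.
  obtain ⟨τ, hτ, hlim⟩ := hap.exists_tendsto
  have hval : 4 * (l₀ - l₁) ^ 2 * ‖expSum ρE h₀.eigenvectorBasis h₁.eigenvectorBasis
      h₀.eigenvalues h₁.eigenvalues 0‖ ^ 2 = (l₀ - l₁) ^ 2 := by
    rw [h0]
    norm_num
    ring
  rw [hval] at hlim
  have hlim' : ∀ ω, Tendsto (fun m => qfi (fun w => traceFst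
      (limitState HEP G C₀ C₁ ρE w (τ m))) ω / τ m ^ 2) atTop (𝓝 ((l₀ - l₁) ^ 2)) := fun ω => by
    refine hlim.congr' ?_
    filter_upwards [hτ.eventually_gt_atTop 0] with m hm
    exact (hdiv ω (τ m) hm).symm
  refine ⟨h0, hle, hap, limitState HEP G C₀ C₁ ρE, fun ω t _ =>
    ⟨h.tendsto_protocolState HEP ρE ω t, h.isDensity_limitState hH hG hρ ω t,
      h.differentiableAt_traceFst_limitState hH hG hρ ω t, hq ω t⟩, fun ω => ?_, τ, hτ, hlim'⟩
  refine limsup_coe_eq_of_le_of_tendsto ?_ hτ (hlim' ω)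
  -- For `t > 0` the quotient is the envelope, and `|α| ≤ ½` bounds that by `4 (Δλ)² · ¼`.
  filter_upwards [eventually_gt_atTop 0] with t ht
  rw [hdiv ω t ht]
  have h1 := pow_le_pow_left₀ (norm_nonneg _) (hle t) 2
  nlinarith [mul_le_mul_of_nonneg_left h1 (sq_nonneg (l₀ - l₁))]
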